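/- Let $\mathcal S$ be a separable complete metric space and $\mathbb N=\{1,2,\dots\}$. Let $K\colon(\mathcal S\times\mathbb N)^2\to[0,\infty)$ be measurable and symmetric, and let $\Upsilon$ be a Markov kernel from $(\mathcal S\times\mathbb N)^2$ to $\mathcal S$ with $\Upsilon(y,y',\cdot)=\Upsilon(y',y,\cdot)$. Assume $$H:=\sup\Big\{\int\!\!\int K(y,y')\,w(\mathrm dy')\,v(\mathrm dy)\colon \|v\|_1,\|w\|_1\le 1\Big\}<\infty,\qquad \|v\|_1=\int m\,v(\mathrm d(x,m)),$$ where $v,w$ range over the measures on $\mathcal S\times\mathbb N$. For a finite point measure $k=\sum_{i=1}^{|k|}\delta_{x_i}$ on $\mathcal S$, let $\mathbb P_k$ be the law of the Marcus–Lushnikov process $\Xi=(\Xi_t)_{t\ge0}$, i.e. the Markov jump process on finite point measures on $\mathcal S\times\mathbb N$ started from $\sum_i\delta_{(x_i,1)}$ in which each unordered pair of particles at $y=(x,m)$, $y'=(x',m')$ coagulates at rate $K(y,y')$ and is then replaced by a particle at $(z,m+m')$ with $z$ chosen according to $\Upsilon(y,y',\mathrm dz)$. Let $\mathbb P^{(N)}_k$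 be the law when $K$ is replaced by $\frac1NK$. For $T\in(0,\infty)$ let $\Gamma_T^{(1)}$ be the set of càdlàg piecewise constant paths $\xi=(\xi_t)_{t\in[0,T]}$ of finite point measures on $\mathcal S\times\mathbb N$ such that $\xi_0$ is concentrated on $\mathcal S\times\{1\}$, every jump is of the form $\phi\mapsto\phi-\delta_{(x,m)}-\delta_{(x',m')}+\delta_{(z,m+m')}$ with $\delta_{(x,m)}+\delta_{(x',m')}\le\phi$, and $\xi_T(\mathcal S\times\mathbb N)=1$. It carries the Skorohod $J_1$-topology (the point measures carrying the Lévy–Prohorov metric) and its Borel $\sigma$-algebra. For $k\ne0$ let $\mathbb Q_k^{(T)}$ be the measure on $\Gamma_T^{(1)}$ that is the image, under the map that builds the path, of the product of the successive coagulation rates, $\prod_{i=1}^{|k|-1}\big(\sum_{\{y,y'\}}K(y,y')\,\Upsilon(y,y',\mathrm dz_i)\big)$ (the $i$-th sum runs over the unordered pairs of particles present before the $i$-th coagulation), and of Lebesgue measure $\mathrm ds_1\cdots\mathrm ds_{|k|-1}$ on inter-coagulation times $s_i>0$ with $\sum_i s_i\le T$. Put $\mathbb Q_0^{(T)}=0$.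 Then for every $T\in(0,\infty)$ and every finite point measure $k$ on $\mathcal S$, the measures $\mathbb P^{(N)}_k(\Xi\in\cdot)|_{\Gamma_T^{(1)}}$ and $\mathbb Q_k^{(T)}$ depend only on $k$ (not on the enumeration of its atoms), $\mathbb Q_k^{(T)}$ is finite, and $$N^{|k|-1}\,\mathbb P^{(N)}_k(\Xi\in\cdot)|_{\Gamma_T^{(1)}}\ \longrightarrow\ \mathbb Q_k^{(T)}\qquad\text{weakly as }N\to\infty.$$ Moreover, let $\mu$ be a probability measure on $\mathcal S$, let $\mathrm{Poi}_\mu$ be the law of a Poisson point process with intensity $\mu$, and define the measures on $\Gamma_T^{(1)}$ $$M^{(T)}_{\mu,N}(\mathrm d\xi)=N^{|\xi_0|-1}\,\mathrm e\int\mathrm{Poi}_\mu(\mathrm dk)\,\mathbb P^{(N)}_k(\Xi\in\mathrm d\xi),\qquad M^{(T)}_\mu(\mathrm d\xi)=\mathrm e\int\mathrm{Poi}_\mu(\mathrm dk)\,\mathbb Q^{(T)}_k(\mathrm d\xi).$$ Then each $M^{(T)}_{\mu,N}$ is finite and $M^{(T)}_{\mu,N}\to M^{(T)}_\mu$ as $N\to\infty$,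 in the sense that $\int f\,\mathrm dM^{(T)}_{\mu,N}\to\int f\,\mathrm dM^{(T)}_\mu$ in $[0,\infty]$ for every bounded continuous $f\colon\Gamma_T^{(1)}\to[0,\infty)$. In particular, if $M^{(T)}_\mu$ has finite total mass, this is weak convergence of finite measures. -/

import Mathlib

open MeasureTheory ProbabilityTheory Filter Topology
open scoped ENNReal NNReal BoundedContinuousFunction

namespace Coag

universe u

instance instMeasurableSpacePNat : MeasurableSpace ℕ+ := ⊤

instance instDiscretePNat : DiscreteMeasurableSpace ℕ+ := ⟨fun _ => trivial⟩

instance instBorelPNat : BorelSpace ℕ+ := ⟨by rw [borel_eq_top_of_discrete]; rfl⟩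

/-- A particle: a site in `S` together with a positive integer mass. -/
abbrev Particle (S : Type u) : Type u := S × ℕ+

/-- A finite point measure on `S × ℕ` (a finite sum of Dirac measures, with multiplicities),
recorded as the multiset of its atoms. -/
abbrev Config (S : Type u) : Type u := Multiset (Particle S)

/-- The measure `∑ δ_y` that a configuration stands for. -/
noncomputable def Config.toMeasure {S : Type u} [MeasurableSpace S] (φ : Config S) :
    Measure (Particle S) := (φ.map Measure.dirac).sum

/-- A coagulation step `φ ↦ φ - δ_y - δ_y' + δ_(z, m + m')`, where `y` and `y'` are two particles
of `φ` (the same point only if it has multiplicity at least two). -/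
def Step {S : Type u} (φ ψ : Config S) : Prop :=
  ∃ (y y' : Particle S) (z : S) (χ : Config S),
    φ = y ::ₘ y' ::ₘ χ ∧ ψ = (z, y.2 + y'.2) ::ₘ χ

/-- Coagulation trajectories on `[0, T]`: all initial masses are one, and the path is càdlàg and
piecewise constant, with finitely many jumps (at strictly increasing positive times), each of which
is a coagulation step. -/
def IsTrajectory {S : Type u} (T : ℝ≥0) (ξ : Set.Icc (0 : ℝ) T → Config S) : Prop :=
  (∀ y ∈ ξ ⟨0, le_rfl, T.2⟩, y.2 = 1) ∧
  ∃ (n : ℕ) (t : ℕ → ℝ) (φ : ℕ → Config S),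
    t 0 = 0 ∧ (∀ i < n, t i < t (i + 1)) ∧ t n ≤ T ∧
    (∀ i < n, Step (φ i) (φ (i + 1))) ∧
    (∀ i < n, ∀ s : Set.Icc (0 : ℝ) T, t i ≤ s → s < t (i + 1) → ξ s = φ i) ∧
    (∀ s : Set.Icc (0 : ℝ) T, t n ≤ s → ξ s = φ n)

/-- The set `Γ_T^(1)` of coagulation trajectories on `[0, T]` that end in a single particle. -/
def OneTraj (S : Type u) (T : ℝ≥0) : Type u :=
  {ξ : Set.Icc (0 : ℝ) T → Config S //
    IsTrajectory T ξ ∧ Multiset.card (ξ ⟨T, T.2, le_rfl⟩) = 1}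

/-- The number `|ξ_0|` of initial atoms. -/
def OneTraj.atoms {S : Type u} {T : ℝ≥0} (ξ : OneTraj S T) : ℕ :=
  Multiset.card (ξ.1 ⟨0, le_rfl, T.2⟩)

set_option linter.unusedSectionVars false

section Topology

variable {S : Type u} [MetricSpace S] [SecondCountableTopology S] [MeasurableSpace S]
  [BorelSpace S] {T : ℝ≥0}

/-- Skorokhod's `J_1` distance: the infimum over all time changes `l` (increasing bijections of
`[0, T]`) of the maximum of `sup_t |l t - t|` and `sup_t d(ξ_(l t), η_t)`, where `d` is the
Lévy-Prokhorov metric on finite measures on `S × ℕ`. -/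
noncomputable def skorokhodEDist (ξ η : Set.Icc (0 : ℝ) T → Config S) : ℝ≥0∞ :=
  ⨅ l : Set.Icc (0 : ℝ) T ≃o Set.Icc (0 : ℝ) T,
    max (⨆ t, edist (l t) t)
      (⨆ t, levyProkhorovEDist (ξ (l t)).toMeasure (η t).toMeasure)

theorem skorokhodEDist_self (ξ : Set.Icc (0 : ℝ) T → Config S) : skorokhodEDist ξ ξ = 0 := by
  refine le_antisymm (iInf_le_of_le (OrderIso.refl _) ?_) zero_le
  simp [levyProkhorovEDist_self]

theorem skorokhodEDist_le (ξ η : Set.Icc (0 : ℝ) T → Config S) :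
    skorokhodEDist ξ η ≤ skorokhodEDist η ξ := by
  refine le_iInf fun l => iInf_le_of_le l.symm ?_
  refine max_le_max ?_ ?_
  · refine iSup_le fun t => ?_
    refine le_iSup_of_le (l.symm t) ?_
    rw [edist_comm]; simp
  · refine iSup_le fun t => ?_
    refine le_iSup_of_le (l.symm t) ?_
    rw [levyProkhorovEDist_comm]; simp

theorem skorokhodEDist_triangle (ξ η ζ : Set.Icc (0 : ℝ) T → Config S) :
    skorokhodEDist ξ ζ ≤ skorokhodEDist ξ η + skorokhodEDist η ζ := by
  unfold skorokhodEDist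
  refine ENNReal.le_iInf_add_iInf fun l l' => iInf_le_of_le (l'.trans l) ?_
  refine max_le ?_ ?_
  · refine iSup_le fun t => (edist_triangle _ (l' t) _).trans (add_le_add ?_ ?_)
    · exact le_max_of_le_left (le_iSup (fun t => edist (l t) t) (l' t))
    · exact le_max_of_le_left (le_iSup (fun t => edist (l' t) t) t)
  · refine iSup_le fun t =>
      (levyProkhorovEDist_triangle _ (η (l' t)).toMeasure _).trans (add_le_add ?_ ?_)
    · exact le_max_of_le_right
        (le_iSup (fun t => levyProkhorovEDist (ξ (l t)).toMeasure (η t).toMeasure) (l' t))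
    · exact le_max_of_le_right
        (le_iSup (fun t => levyProkhorovEDist (η (l' t)).toMeasure (ζ t).toMeasure) t)

/-- `Γ_T^(1)` carries the Skorokhod `J_1` topology and its Borel sigma-algebra. -/
noncomputable instance : PseudoEMetricSpace (OneTraj S T) where
  edist ξ η := skorokhodEDist ξ.1 η.1
  edist_self ξ := skorokhodEDist_self ξ.1
  edist_comm ξ η := le_antisymm (skorokhodEDist_le _ _) (skorokhodEDist_le _ _)
  edist_triangle ξ η ζ := skorokhodEDist_triangle _ _ _

noncomputable instance : MeasurableSpace (OneTraj S T) := borel _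

instance : BorelSpace (OneTraj S T) := ⟨rfl⟩

end Topology

section Histories

variable {S : Type u}

/-- Unordered pairs of labels of particles. -/
abbrev Pair (n : ℕ) : Type := {p : Fin n × Fin n // p.1 < p.2}

/-- The system of particles after particles `i < j` have been replaced by one particle at `z` with
the sum of their masses (it takes label `i`; label `j` is removed). -/
def merge {n : ℕ} (x : Fin (n + 2) → Particle S) (p : Pair (n + 2)) (z : S) :
    Fin (n + 1) → Particle S :=
  fun l => Function.update x p.1.1 (z, (x p.1.1).2 + (x p.1.2).2) (p.1.2.succAbove l)

/-- The point measure of a finite system of labelled particles. -/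
def conf {n : ℕ} (x : Fin n → Particle S) : Config S := Finset.univ.val.map x

/-- A history of a system that starts with `n + 1` particles: for each of its `n` successive
coagulations the pair that coagulates, the site of the new particle, and the waiting time since the
previous coagulation. A waiting time `∞` means that this coagulation and the later ones never happen. -/
def Hist (S : Type u) : ℕ → Type u
  | 0 => PUnit
  | n + 1 => ((Pair (n + 2) × S) × ℝ≥0∞) × Hist S n

/-- The configuration `Ξ_t` at time `t` of the system with initial particles `x` and history `h`. -/
noncomputable def Hist.path : (n : ℕ) → (Fin (n + 1) → Particle S) → Hist S n → ℝ → Config S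
  | 0, x, _, _ => conf x
  | n + 1, x, (((p, z), s), h), t =>
      if ENNReal.ofReal t < s then conf x else Hist.path n (merge x p z) h (t - s.toReal)

/-- The path `(Ξ_t)_{t ∈ [0, T]}`. -/
noncomputable def Hist.restrict (T : ℝ≥0) {n : ℕ} (x : Fin (n + 1) → Particle S) (h : Hist S n) :
    Set.Icc (0 : ℝ) T → Config S :=
  fun t => Hist.path n x h t

/-- All waiting times are positive. -/
def Hist.Pos : (n : ℕ) → Hist S n → Prop
  | 0, _ => True
  | n + 1, (((_, _), s), h) => 0 < s ∧ Hist.Pos n h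

/-- The sum of all waiting times. -/
noncomputable def Hist.total : (n : ℕ) → Hist S n → ℝ≥0∞
  | 0, _ => 0
  | n + 1, (((_, _), s), h) => s + Hist.total n h

theorem card_conf {n : ℕ} (x : Fin n → Particle S) : Multiset.card (conf x) = n := by
  simp [conf]

/-- Merging is a coagulation step. -/
theorem exists_conf_eq {n : ℕ} (x : Fin (n + 2) → Particle S) (p : Pair (n + 2)) :
    ∃ χ : Config S, conf x = x p.1.1 ::ₘ x p.1.2 ::ₘ χ ∧
      ∀ z, conf (merge x p z) = (z, (x p.1.1).2 + (x p.1.2).2) ::ₘ χ := by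
  obtain ⟨⟨i, j⟩, hij⟩ := p
  have hne : i ≠ j := ne_of_lt hij
  obtain ⟨i', rfl⟩ := Fin.exists_succAbove_eq hne
  refine ⟨(Finset.univ.erase i').val.map (fun l => x (j.succAbove l)), ?_, fun z => ?_⟩
  · have h1 : conf x = x j ::ₘ (Finset.univ.val.map (fun l => x (j.succAbove l))) := by
      simp only [conf]
      rw [Fin.univ_succAbove (n + 1) j]
      simp [Function.comp_def]
    have h2 : (Finset.univ : Finset (Fin (n + 1))).val = i' ::ₘ (Finset.univ.erase i').val := by
      rw [← Finset.insert_val_of_notMem (by simp), Finset.insert_erase (Finset.mem_univ _)]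
    rw [h1, h2, Multiset.map_cons, Multiset.cons_swap]
  · have h2 : (Finset.univ : Finset (Fin (n + 1))).val = i' ::ₘ (Finset.univ.erase i').val := by
      rw [← Finset.insert_val_of_notMem (by simp), Finset.insert_erase (Finset.mem_univ _)]
    rw [conf, h2, Multiset.map_cons]
    congr 1
    · simp [merge]
    · refine Multiset.map_congr rfl fun l hl => ?_
      have : l ≠ i' := Finset.ne_of_mem_erase (Finset.mem_def.2 hl)
      simp [merge, Function.update_of_ne, this]

theorem lt_iff_of_ne {t : ℝ} {s : ℝ≥0∞} (h0 : 0 < s) (h1 : s ≠ ∞) :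
    ENNReal.ofReal t < s ↔ t < s.toReal := by
  rcases lt_or_ge t 0 with ht | ht
  · simp only [ENNReal.ofReal_of_nonpos ht.le, h0, true_iff]
    exact ht.trans_le ENNReal.toReal_nonneg
  · exact ENNReal.ofReal_lt_iff_lt_toReal ht h1

theorem card_path_le (n : ℕ) (x : Fin (n + 1) → Particle S) (h : Hist S n) (t : ℝ) :
    Multiset.card (h.path n x t) ≤ n + 1 := by
  induction n generalizing t with
  | zero => simp [Hist.path, card_conf]
  | succ n ih =>
    obtain ⟨⟨⟨p, z⟩, s⟩, h⟩ := h
    simp only [Hist.path]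
    split_ifs
    · simp [card_conf]
    · exact (ih _ _ _).trans (by omega)

theorem total_le_of_card (n : ℕ) (x : Fin (n + 1) → Particle S) (h : Hist S n) (t : ℝ)
    (ht : 0 ≤ t) (hc : Multiset.card (h.path n x t) = 1) : h.total n ≤ ENNReal.ofReal t := by
  induction n generalizing t with
  | zero => simp [Hist.total]
  | succ n ih =>
    obtain ⟨⟨⟨p, z⟩, s⟩, h⟩ := h
    simp only [Hist.path, Hist.total] at hc ⊢
    split_ifs at hc with hs
    · simp [card_conf] at hc
    · have hs' : s ≠ ∞ := ne_top_of_le_ne_top ENNReal.ofReal_ne_top (not_lt.1 hs)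
      have hle : s.toReal ≤ t := ENNReal.toReal_le_of_le_ofReal ht (not_lt.1 hs)
      have := ih _ _ _ (sub_nonneg.2 hle) hc
      calc s + h.total n ≤ s + ENNReal.ofReal (t - s.toReal) := by gcongr
        _ = ENNReal.ofReal s.toReal + ENNReal.ofReal (t - s.toReal) := by
          rw [ENNReal.ofReal_toReal hs']
        _ = ENNReal.ofReal t := by
          rw [← ENNReal.ofReal_add ENNReal.toReal_nonneg (sub_nonneg.2 hle)]; congr 1; ring

/-- The total mass of a configuration. -/
def massOf (φ : Config S) : ℕ := (φ.map fun y => (y.2 : ℕ)).sum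

theorem massOf_conf {n : ℕ} (x : Fin n → Particle S) : massOf (conf x) = ∑ i, ((x i).2 : ℕ) := by
  simp only [massOf, conf, Multiset.map_map]; rfl

theorem massOf_merge {n : ℕ} (x : Fin (n + 2) → Particle S) (p : Pair (n + 2)) (z : S) :
    massOf (conf (merge x p z)) = massOf (conf x) := by
  obtain ⟨χ, h1, h2⟩ := exists_conf_eq x p
  rw [h1, h2]
  simp [massOf, add_assoc]

theorem massOf_path (n : ℕ) (x : Fin (n + 1) → Particle S) (h : Hist S n) (t : ℝ) :
    massOf (h.path n x t) = massOf (conf x) := by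
  induction n generalizing t with
  | zero => simp [Hist.path]
  | succ n ih =>
    obtain ⟨⟨⟨p, z⟩, s⟩, h⟩ := h
    simp only [Hist.path]
    split_ifs
    · rfl
    · rw [ih, massOf_merge]

theorem pos_of_attained (n : ℕ) (x : Fin (n + 1) → Particle S) (h : Hist S n)
    (H : ∀ j, 1 ≤ j → j ≤ n + 1 → ∃ t : ℝ, Multiset.card (h.path n x t) = j) : h.Pos n := by
  induction n with
  | zero => trivial
  | succ n ih =>
    obtain ⟨⟨⟨p, z⟩, s⟩, h⟩ := h
    simp only [Hist.path, Hist.Pos] at H ⊢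
    constructor
    · obtain ⟨t, ht⟩ := H (n + 2) (by omega) le_rfl
      split_ifs at ht with hs
      · exact lt_of_le_of_lt zero_le hs
      · have := card_path_le n (merge x p z) h (t - s.toReal)
        omega
    · refine ih (merge x p z) h fun j hj hj' => ?_
      obtain ⟨t, ht⟩ := H j hj (by omega)
      split_ifs at ht with hs
      · rw [card_conf] at ht; omega
      · exact ⟨_, ht⟩

theorem card_step {φ ψ : Config S} (h : Step φ ψ) :
    Multiset.card φ = Multiset.card ψ + 1 := by
  obtain ⟨y, y', z, χ, rfl, rfl⟩ := h
  simp

theorem attained {T : ℝ≥0} {ξ : Set.Icc (0 : ℝ) T → Config S} (h : IsTrajectory T ξ)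
    (h1 : Multiset.card (ξ ⟨T, T.2, le_rfl⟩) = 1) (j : ℕ) (hj : 1 ≤ j)
    (hj' : j ≤ Multiset.card (ξ ⟨0, le_rfl, T.2⟩)) : ∃ t, Multiset.card (ξ t) = j := by
  obtain ⟨-, n, t, φ, t0, tm, tn, hs, hc, hl⟩ := h
  have mono : ∀ a b, a ≤ b → b ≤ n → t a ≤ t b := by
    intro a b hab hb
    induction b, hab using Nat.le_induction with
    | base => exact le_rfl
    | succ b hab ih => exact (ih (by omega)).trans (tm b (by omega)).le
  have hmem : ∀ i, i ≤ n → t i ∈ Set.Icc (0 : ℝ) T := fun i hi =>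
    ⟨t0 ▸ mono 0 i (Nat.zero_le _) hi, (mono i n hi le_rfl).trans tn⟩
  have hφ : ∀ i (hi : i ≤ n), ξ ⟨t i, hmem i hi⟩ = φ i := by
    intro i hi
    rcases hi.lt_or_eq with hi | rfl
    · exact hc i hi _ le_rfl (tm i hi)
    · exact hl _ le_rfl
  have hcard : ∀ i, i ≤ n → Multiset.card (φ i) + i = Multiset.card (φ 0) := by
    intro i hi
    induction i with
    | zero => rfl
    | succ i ih => have := card_step (hs i hi); have := ih (by omega); omega
  have hT : Multiset.card (φ n) = 1 := by rw [← h1, hl _ tn]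
  have h0 : ξ ⟨0, le_rfl, T.2⟩ = φ 0 := by
    rw [← hφ 0 (Nat.zero_le _)]; congr 1; exact Subtype.ext t0.symm
  rw [h0] at hj'
  have := hcard n le_rfl
  refine ⟨⟨t (Multiset.card (φ 0) - j), hmem _ (by omega)⟩, ?_⟩
  rw [hφ _ (by omega)]
  have := hcard (Multiset.card (φ 0) - j) (by omega)
  omega

theorem steps_of_pos (n : ℕ) (x : Fin (n + 1) → Particle S) (h : Hist S n) (hp : h.Pos n)
    (ht : h.total n ≠ ∞) :
    ∃ (t : ℕ → ℝ) (φ : ℕ → Config S),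
      t 0 = 0 ∧ (∀ i < n, t i < t (i + 1)) ∧ t n = (h.total n).toReal ∧
      φ 0 = conf x ∧ Multiset.card (φ n) = 1 ∧
      (∀ i < n, Step (φ i) (φ (i + 1))) ∧
      (∀ i < n, ∀ s : ℝ, t i ≤ s → s < t (i + 1) → h.path n x s = φ i) ∧
      (∀ s : ℝ, t n ≤ s → h.path n x s = φ n) := by
  induction n with
  | zero =>
    refine ⟨fun _ => 0, fun _ => conf x, rfl, by simp, by simp [Hist.total], rfl,
      by simp [card_conf], by simp, by simp, fun s _ => rfl⟩
  | succ n ih =>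
    obtain ⟨⟨⟨p, z⟩, s⟩, h⟩ := h
    simp only [Hist.Pos, Hist.total] at hp ht
    obtain ⟨hst, htt⟩ := ENNReal.add_ne_top.1 ht
    obtain ⟨t, φ, t0, tm, tn, φ0, c1, hs, hc, hl⟩ := ih (merge x p z) h hp.2 htt
    have hspos : 0 < s.toReal := ENNReal.toReal_pos hp.1.ne' hst
    have mono : ∀ b, b ≤ n → 0 ≤ t b := by
      intro b hb
      induction b with
      | zero => exact t0.ge
      | succ b ih => exact (ih (by omega)).trans (tm b (by omega)).le
    have tail : ∀ u : ℝ, s.toReal ≤ u →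
        Hist.path (n + 1) x ((((p, z), s), h) : Hist S (n + 1)) u =
          h.path n (merge x p z) (u - s.toReal) := by
      intro u hu
      simp only [Hist.path]
      rw [if_neg]
      rw [lt_iff_of_ne hp.1 hst]; exact not_lt.2 hu
    refine ⟨fun i => Nat.casesOn i 0 fun i => t i + s.toReal,
      fun i => Nat.casesOn i (conf x) φ, rfl, ?_, ?_, rfl, c1, ?_, ?_, ?_⟩
    · rintro (_ | i) hi
      · simpa [t0] using hspos
      · simpa using tm i (by omega)
    · simp [tn, Hist.total, ENNReal.toReal_add hst htt, add_comm]
    · rintro (_ | i) hi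
      · obtain ⟨χ, h1, h2⟩ := exists_conf_eq x p
        exact ⟨_, _, z, χ, h1, by simp [φ0, h2]⟩
      · exact hs i (by omega)
    · rintro (_ | i) hi u hu hu'
      · simp only [t0, zero_add] at hu'
        exact if_pos ((lt_iff_of_ne hp.1 hst).2 hu')
      · simp only at hu hu'
        have := mono i (by omega)
        rw [tail u (by linarith)]
        exact hc i (by omega) _ (by linarith) (by linarith)
    · intro u hu
      simp only at hu
      have := mono n le_rfl
      rw [tail u (by linarith)]
      exact hl _ (by linarith)

/-- The path of a history on `[0, T]` lies in `Γ_T^(1)` if and only if all initial masses are one, the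
waiting times are positive and all coagulations happen by time `T`. -/
theorem isOneTraj_iff {T : ℝ≥0} {n : ℕ} (x : Fin (n + 1) → Particle S) (h : Hist S n) :
    (IsTrajectory T (h.restrict T x) ∧
      Multiset.card (h.restrict T x ⟨T, T.2, le_rfl⟩) = 1) ↔
    (∀ i, (x i).2 = 1) ∧ h.Pos n ∧ h.total n ≤ T := by
  constructor
  · rintro ⟨h1, h2⟩
    have hm : massOf (h.restrict T x ⟨0, le_rfl, T.2⟩) =
        Multiset.card (h.restrict T x ⟨0, le_rfl, T.2⟩) := by
      rw [massOf, Multiset.map_congr rfl (g := fun _ => 1)]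
      · simp
      · intro y hy; simp [h1.1 y hy]
    have hm2 : massOf (conf x) = Multiset.card (h.restrict T x ⟨0, le_rfl, T.2⟩) := by
      rw [← hm]; exact (massOf_path n x h 0).symm
    have hle : Multiset.card (h.restrict T x ⟨0, le_rfl, T.2⟩) ≤ n + 1 := card_path_le n x h 0
    have hsum : ∑ i, ((x i).2 : ℕ) = ∑ i : Fin (n + 1), 1 := by
      refine le_antisymm ?_ (Finset.sum_le_sum fun i _ => (x i).2.pos)
      rw [← massOf_conf, hm2]; simpa using hle
    have hone : ∀ i, (x i).2 = 1 := by
      intro i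
      have := (Finset.sum_eq_sum_iff_of_le
        (fun i _ => Nat.succ_le_of_lt (x i).2.pos)).1 hsum.symm i (Finset.mem_univ i)
      exact PNat.coe_injective (by simpa using this.symm)
    refine ⟨hone, ?_, ?_⟩
    · refine pos_of_attained n x h fun j hj hj' => ?_
      obtain ⟨t, ht⟩ := attained h1 h2 j hj (by
        rw [← hm2, massOf_conf, hsum]; simpa using hj')
      exact ⟨t, ht⟩
    · have := total_le_of_card n x h T T.2 h2
      simpa using this
  · rintro ⟨hx, hp, ht⟩
    have htop : h.total n ≠ ∞ := ne_top_of_le_ne_top ENNReal.coe_ne_top ht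
    have hT : (h.total n).toReal ≤ T := by
      simpa using ENNReal.toReal_mono ENNReal.coe_ne_top ht
    obtain ⟨t, φ, t0, tm, tn, φ0, c1, hs, hc, hl⟩ := steps_of_pos n x h hp htop
    refine ⟨⟨?_, n, t, φ, t0, tm, tn ▸ hT, hs, fun i hi s => hc i hi s, fun s => hl s⟩, ?_⟩
    · have h0 : h.restrict T x ⟨0, le_rfl, T.2⟩ = conf x := by
        rw [← φ0]
        rcases Nat.eq_zero_or_pos n with rfl | hn
        · exact hl _ t0.le
        · exact hc 0 hn _ t0.le (by simpa [t0] using tm 0 hn)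
      rw [h0]
      intro y hy
      obtain ⟨i, -, rfl⟩ := Multiset.mem_map.1 hy
      exact hx i
    · rw [← c1]; congr 1; exact hl _ (tn ▸ hT)

end Histories

section PathMeasurable

variable {S : Type u} [MetricSpace S] [SecondCountableTopology S] [MeasurableSpace S]
  [BorelSpace S] {T : ℝ≥0}

instance Hist.instMeasurableSpace {S : Type u} [MeasurableSpace S] :
    (n : ℕ) → MeasurableSpace (Hist S n)
  | 0 => inferInstanceAs (MeasurableSpace PUnit)
  | n + 1 =>
    let _ := Hist.instMeasurableSpace (S := S) n
    inferInstanceAs (MeasurableSpace (((Pair (n + 2) × S) × ℝ≥0∞) × Hist S n))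

instance Hist.instTopologicalSpace {S : Type u} [TopologicalSpace S] :
    (n : ℕ) → TopologicalSpace (Hist S n)
  | 0 => inferInstanceAs (TopologicalSpace PUnit)
  | n + 1 =>
    let _ := Hist.instTopologicalSpace (S := S) n
    inferInstanceAs (TopologicalSpace (((Pair (n + 2) × S) × ℝ≥0∞) × Hist S n))

instance Hist.instSecondCountable : (n : ℕ) → SecondCountableTopology (Hist S n)
  | 0 => inferInstanceAs (SecondCountableTopology PUnit)
  | n + 1 =>
    let _ := Hist.instSecondCountable n
    inferInstanceAs (SecondCountableTopology (((Pair (n + 2) × S) × ℝ≥0∞) × Hist S n))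

instance Hist.instOpensMeasurable : (n : ℕ) → OpensMeasurableSpace (Hist S n)
  | 0 => inferInstanceAs (OpensMeasurableSpace PUnit)
  | n + 1 =>
    let _ := Hist.instOpensMeasurable n
    inferInstanceAs (OpensMeasurableSpace (((Pair (n + 2) × S) × ℝ≥0∞) × Hist S n))

theorem Hist.measurable_total {S : Type u} [MeasurableSpace S] (n : ℕ) :
    Measurable (Hist.total (S := S) n) := by
  induction n with
  | zero => exact measurable_const
  | succ n ih =>
    exact (measurable_fst.snd).add (ih.comp measurable_snd)

theorem Hist.measurableSet_pos {S : Type u} [MeasurableSpace S] (n : ℕ) :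
    MeasurableSet {h : Hist S n | h.Pos n} := by
  induction n with
  | zero => exact MeasurableSet.univ
  | succ n ih =>
    exact (measurableSet_lt measurable_const measurable_fst.snd).inter
      (measurable_snd ih)

/-- The event `{Ξ ∈ Γ_T^(1)}`. -/
def oneSet (S : Type u) (T : ℝ≥0) (n : ℕ) : Set ((Fin (n + 1) → Particle S) × Hist S n) :=
  {ω | IsTrajectory T (ω.2.restrict T ω.1) ∧
    Multiset.card (ω.2.restrict T ω.1 ⟨T, T.2, le_rfl⟩) = 1}

theorem measurableSet_oneSet {S : Type u} [MeasurableSpace S] (T : ℝ≥0) (n : ℕ) :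
    MeasurableSet (oneSet S T n) := by
  have : oneSet S T n = {ω | (∀ i, (ω.1 i).2 = 1) ∧ ω.2.Pos n ∧ ω.2.total n ≤ (T : ℝ≥0∞)} := by
    ext ω; exact isOneTraj_iff ω.1 ω.2
  rw [this]
  refine MeasurableSet.inter ?_ (MeasurableSet.inter ?_ ?_)
  · have : {ω : (Fin (n + 1) → Particle S) × Hist S n | ∀ i, (ω.1 i).2 = 1} =
        ⋂ i, (fun ω => (ω.1 i).2) ⁻¹' {1} := by ext; simp
    change MeasurableSet {ω : (Fin (n + 1) → Particle S) × Hist S n | ∀ i, (ω.1 i).2 = 1}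
    rw [this]
    refine MeasurableSet.iInter fun i => ?_
    exact ((measurable_pi_apply i).comp measurable_fst).snd (MeasurableSet.of_discrete)
  · exact measurable_snd (Hist.measurableSet_pos n)
  · exact measurableSet_le ((Hist.measurable_total n).comp measurable_snd) measurable_const

/-- The path `Ξ`, on the event that it lies in `Γ_T^(1)`. -/
noncomputable def pathMap (S : Type u) (T : ℝ≥0) (n : ℕ) (ω : oneSet S T n) : OneTraj S T :=
  ⟨ω.1.2.restrict T ω.1.1, ω.2⟩

theorem levyProkhorov_conf_le {n : ℕ} (x y : Fin n → Particle S) {ε : ℝ}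
    (h : ∀ i, dist (x i) (y i) < ε) :
    levyProkhorovEDist (conf x).toMeasure (conf y).toMeasure ≤ ENNReal.ofReal ε := by
  have hm : ∀ x : Fin n → Particle S, (conf x).toMeasure = ∑ i, Measure.dirac (x i) := by
    intro x
    simp only [conf, Config.toMeasure, Multiset.map_map]; rfl
  have key : ∀ x y : Fin n → Particle S, (∀ i, dist (x i) (y i) < ε) → ∀ (δ : ℝ) (B : Set _),
      ε ≤ δ → MeasurableSet B → (conf x).toMeasure B ≤
        (conf y).toMeasure (Metric.thickening δ B) := by
    intro x y h δ B hδ hB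
    rw [hm, hm, Measure.finsetSum_apply, Measure.finsetSum_apply]
    refine Finset.sum_le_sum fun i _ => ?_
    rw [Measure.dirac_apply' _ hB, Measure.dirac_apply' _ Metric.isOpen_thickening.measurableSet]
    by_cases hx : x i ∈ B
    · have hy : y i ∈ Metric.thickening δ B :=
        Metric.mem_thickening_iff.2 ⟨x i, hx, by rw [dist_comm]; exact (h i).trans_le hδ⟩
      simp [hx, hy]
    · simp [hx]
  refine levyProkhorovEDist_le_of_forall _ _ _ fun δ B h1 h2 hB => ?_
  have hδ : ε ≤ δ.toReal := by
    rw [← ENNReal.ofReal_le_iff_le_toReal h2.ne]; exact h1.le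
  exact ⟨(key x y h _ B hδ hB).trans le_self_add,
    (key y x (fun i => by rw [dist_comm]; exact h i) _ B hδ hB).trans le_self_add⟩

/-- Two initial systems and histories with the same pairs, nearby particles and nearby waiting times. -/
def Close (ε : ℝ) : (n : ℕ) → (Fin (n + 1) → Particle S) → Hist S n →
    (Fin (n + 1) → Particle S) → Hist S n → Prop
  | 0, x, _, y, _ => ∀ i, dist (x i) (y i) < ε
  | n + 1, x, (((p, z), s), h), y, (((q, w), r), k) => (∀ i, dist (x i) (y i) < ε) ∧ p = q ∧
      |s.toReal - r.toReal| < ε ∧ Close ε n (merge x p z) h (merge y q w) k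

theorem continuous_merge (n : ℕ) (p : Pair (n + 2)) :
    Continuous fun a : (Fin (n + 2) → Particle S) × S => merge a.1 p a.2 := by
  have : Continuous fun a : (Fin (n + 2) → Particle S) × S =>
      Function.update a.1 p.1.1 (a.2, (a.1 p.1.1).2 + (a.1 p.1.2).2) := by
    refine Continuous.update continuous_fst _ ?_
    refine continuous_snd.prodMk ?_
    exact (continuous_of_discreteTopology (f := fun a : ℕ+ × ℕ+ => a.1 + a.2)).comp
      ((((continuous_apply _).comp continuous_fst).snd).prodMk
      (((continuous_apply _).comp continuous_fst).snd))
  exact continuous_pi fun l => (continuous_apply (p.1.2.succAbove l)).comp this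

theorem eventually_close {ε : ℝ} (hε : 0 < ε) (n : ℕ) (y : Fin (n + 1) → Particle S)
    (k : Hist S n) (hk : k.total n ≠ ∞) :
    ∀ᶠ ω : (Fin (n + 1) → Particle S) × Hist S n in 𝓝 (y, k), Close ε n ω.1 ω.2 y k := by
  have hpt : ∀ m (y : Fin m → Particle S), ∀ᶠ x in 𝓝 y, ∀ i, dist (x i) (y i) < ε := by
    intro m y
    refine eventually_all.2 fun i => ?_
    exact (continuous_apply i).continuousAt.eventually (Metric.ball_mem_nhds (y i) hε)
  induction n with
  | zero =>
    exact (continuous_fst (X := Fin (0 + 1) → Particle S) (Y := Hist S 0)).continuousAt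
      (x := (y, k)) |>.eventually (hpt _ y)
  | succ n ih =>
    obtain ⟨⟨⟨q, w⟩, r⟩, k⟩ := k
    simp only [Hist.total] at hk
    obtain ⟨hr, hk⟩ := ENNReal.add_ne_top.1 hk
    have e1 : ∀ᶠ ω : (Fin (n + 2) → Particle S) × ((Pair (n + 2) × S) × ℝ≥0∞) × Hist S n in
        𝓝 (y, ((q, w), r), k), ∀ i, dist (ω.1 i) (y i) < ε :=
      (continuous_fst (X := Fin (n + 2) → Particle S)
        (Y := ((Pair (n + 2) × S) × ℝ≥0∞) × Hist S n)).continuousAt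
        (x := (y, ((q, w), r), k)) |>.eventually (hpt _ y)
    have e2 : ∀ᶠ ω : (Fin (n + 2) → Particle S) × ((Pair (n + 2) × S) × ℝ≥0∞) × Hist S n in
        𝓝 (y, ((q, w), r), k), ω.2.1.1.1 = q :=
      (continuous_snd.fst.fst.fst : Continuous fun ω : (Fin (n + 2) → Particle S) ×
        ((Pair (n + 2) × S) × ℝ≥0∞) × Hist S n => ω.2.1.1.1).continuousAt
        (x := (y, ((q, w), r), k)) |>.eventually
        (IsOpen.mem_nhds (isOpen_discrete {q}) (Set.mem_singleton q))
    have e3 : ∀ᶠ ω : (Fin (n + 2) → Particle S) × ((Pair (n + 2) × S) × ℝ≥0∞) × Hist S n in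
        𝓝 (y, ((q, w), r), k), |ω.2.1.2.toReal - r.toReal| < ε := by
      have : ContinuousAt (fun ω : (Fin (n + 2) → Particle S) ×
          ((Pair (n + 2) × S) × ℝ≥0∞) × Hist S n => ω.2.1.2.toReal) (y, ((q, w), r), k) :=
        ContinuousAt.comp (g := ENNReal.toReal) (ENNReal.continuousAt_toReal hr)
          (continuous_snd.fst.snd).continuousAt
      exact this.eventually (Metric.ball_mem_nhds _ hε)
    have e4 : ∀ᶠ ω : (Fin (n + 2) → Particle S) × ((Pair (n + 2) × S) × ℝ≥0∞) × Hist S n in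
        𝓝 (y, ((q, w), r), k),
          Close ε n (merge ω.1 q ω.2.1.1.2) ω.2.2 (merge y q w) k := by
      have hc : Continuous fun ω : (Fin (n + 2) → Particle S) ×
          ((Pair (n + 2) × S) × ℝ≥0∞) × Hist S n => (merge ω.1 q ω.2.1.1.2, ω.2.2) :=
        ((continuous_merge n q).comp (continuous_fst.prodMk continuous_snd.fst.fst.snd)).prodMk
          continuous_snd.snd
      exact (hc.continuousAt (x := (y, ((q, w), r), k))).eventually (ih (merge y q w) k hk)
    change ∀ᶠ ω : (Fin (n + 2) → Particle S) × ((Pair (n + 2) × S) × ℝ≥0∞) × Hist S n in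
        𝓝 (y, ((q, w), r), k), Close ε (n + 1) ω.1 ω.2 y (((q, w), r), k)
    filter_upwards [e1, e2, e3, e4] with ω h1 h2 h3 h4
    obtain ⟨x, ⟨⟨p, z⟩, s⟩, h⟩ := ω
    simp only at h1 h2 h3 h4
    subst h2
    exact ⟨h1, rfl, h3, h4⟩

theorem exists_timeChange {ε : ℝ} (hε : 0 < ε) (n : ℕ) (x y : Fin (n + 1) → Particle S)
    (h k : Hist S n) (hc : Close ε n x h y k) (hp : h.Pos n) (kp : k.Pos n) (T T' : ℝ)
    (hT : 0 ≤ T) (hT' : 0 ≤ T') (hh : h.total n ≤ ENNReal.ofReal T)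
    (hk : k.total n ≤ ENNReal.ofReal T')
    (hiff : h.total n = ENNReal.ofReal T ↔ k.total n = ENNReal.ofReal T') :
    ∃ l : ℝ → ℝ, StrictMono l ∧ Continuous l ∧ l 0 = 0 ∧ l T' = T ∧
      ∀ t, 0 ≤ t → t ≤ T' → |l t - t| ≤ 2 * n * ε + |T - T'| ∧
        levyProkhorovEDist (h.path n x (l t)).toMeasure (k.path n y t).toMeasure ≤
          ENNReal.ofReal ε := by
  induction n generalizing T T' with
  | zero =>
    have hz : T = 0 ↔ T' = 0 := by
      simp only [Hist.total] at hiff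
      rw [eq_comm, ENNReal.ofReal_eq_zero, eq_comm, ENNReal.ofReal_eq_zero] at hiff
      constructor
      · intro h; exact le_antisymm (hiff.1 h.le) hT'
      · intro h; exact le_antisymm (hiff.2 h.le) hT
    have hlp : ∀ t t', levyProkhorovEDist (h.path 0 x t).toMeasure (k.path 0 y t').toMeasure ≤
          ENNReal.ofReal ε := fun t t' => levyProkhorov_conf_le x y hc
    rcases hT'.eq_or_lt with h0 | h0
    · obtain rfl : T' = 0 := h0.symm
      obtain rfl : T = 0 := hz.2 rfl
      exact ⟨id, strictMono_id, continuous_id, rfl, rfl, fun t _ _ => ⟨by simp, hlp _ _⟩⟩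
    · have h1 : 0 < T := lt_of_le_of_ne hT fun e => h0.ne' (hz.1 e.symm)
      refine ⟨fun t => t * (T / T'), ?_, by fun_prop, by simp, by field_simp, ?_⟩
      · exact fun a b hab => mul_lt_mul_of_pos_right hab (by positivity)
      · intro t ht ht'
        refine ⟨?_, hlp _ _⟩
        have : t * (T / T') - t = (t / T') * (T - T') := by field_simp
        rw [this, abs_mul, abs_of_nonneg (by positivity)]
        have : t / T' ≤ 1 := (div_le_one h0).2 ht'
        simp only [Nat.cast_zero, mul_zero, zero_mul, zero_add]
        exact mul_le_of_le_one_left (abs_nonneg _) this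
  | succ n ih =>
    obtain ⟨⟨⟨p, z⟩, s⟩, h⟩ := h
    obtain ⟨⟨⟨q, w⟩, r⟩, k⟩ := k
    obtain ⟨c1, rfl, c3, c4⟩ := hc
    simp only [Hist.total, Hist.Pos] at hh hk hiff hp kp
    have hs : s ≠ ∞ := ne_top_of_le_ne_top ENNReal.ofReal_ne_top (le_self_add.trans hh)
    have hr : r ≠ ∞ := ne_top_of_le_ne_top ENNReal.ofReal_ne_top (le_self_add.trans hk)
    have s0 : 0 < s.toReal := ENNReal.toReal_pos hp.1.ne' hs
    have r0 : 0 < r.toReal := ENNReal.toReal_pos kp.1.ne' hr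
    have sT : s.toReal ≤ T := ENNReal.toReal_le_of_le_ofReal hT (le_self_add.trans hh)
    have rT : r.toReal ≤ T' := ENNReal.toReal_le_of_le_ofReal hT' (le_self_add.trans hk)
    have split : ∀ (s : ℝ≥0∞) (T : ℝ), s ≠ ∞ → s.toReal ≤ T →
        ENNReal.ofReal T = s + ENNReal.ofReal (T - s.toReal) := by
      intro s T hs hT
      calc ENNReal.ofReal T = ENNReal.ofReal (s.toReal + (T - s.toReal)) := by
            congr 1; ring
        _ = s + ENNReal.ofReal (T - s.toReal) := by
            rw [ENNReal.ofReal_add ENNReal.toReal_nonneg (sub_nonneg.2 hT),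
              ENNReal.ofReal_toReal hs]
    rw [split s T hs sT] at hh hiff
    rw [split r T' hr rT] at hk hiff
    rw [ENNReal.add_right_inj hs, ENNReal.add_right_inj hr] at hiff
    rw [ENNReal.add_le_add_iff_left hs] at hh
    rw [ENNReal.add_le_add_iff_left hr] at hk
    obtain ⟨l, lm, lc, l0, lT, hl⟩ := ih _ _ h k c4 hp.2 kp.2 _ _ (sub_nonneg.2 sT)
      (sub_nonneg.2 rT) hh hk hiff
    refine ⟨fun t => if t ≤ r.toReal then t * (s.toReal / r.toReal)
      else l (t - r.toReal) + s.toReal, ?_, ?_, ?_, ?_, ?_⟩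
    · intro a b hab
      have hpos : 0 < s.toReal / r.toReal := by positivity
      have hrs : r.toReal * (s.toReal / r.toReal) = s.toReal := by field_simp
      simp only
      split_ifs with ha hb hb
      · exact mul_lt_mul_of_pos_right hab hpos
      · have h1 : a * (s.toReal / r.toReal) ≤ s.toReal := by
          exact (mul_le_mul_of_nonneg_right ha hpos.le).trans hrs.le
        have h2 : l 0 < l (b - r.toReal) := lm (by linarith [not_le.1 hb])
        linarith
      · linarith [not_le.1 ha]
      · have := lm (show a - r.toReal < b - r.toReal by linarith)
        linarith
    · refine Continuous.if_le (by fun_prop) (by fun_prop) continuous_id continuous_const ?_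
      rintro t rfl
      simp only [sub_self, l0, zero_add]; field_simp
    · simp [r0.le]
    · simp only
      split_ifs with hle
      · have : T' = r.toReal := le_antisymm hle rT
        rw [this, sub_self, l0] at lT
        rw [this]; field_simp; linarith
      · linarith
    · intro t ht ht'
      have hpath : ∀ (s : ℝ≥0∞) (x : Fin (n + 2) → Particle S) (z : S) (h : Hist S n) (t : ℝ),
          0 < s → s ≠ ∞ → Hist.path (n + 1) x ((((p, z), s), h) : Hist S (n + 1)) t =
            if t < s.toReal then conf x else h.path n (merge x p z) (t - s.toReal) := by
        intro s x z h t h0 h1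
        simp only [Hist.path, lt_iff_of_ne h0 h1]
      rw [hpath s x z h _ hp.1 hs, hpath r y w k _ kp.1 hr]
      have hTT : |T - s.toReal - (T' - r.toReal)| ≤ |T - T'| + ε := by
        have : T - s.toReal - (T' - r.toReal) = (T - T') - (s.toReal - r.toReal) := by ring
        rw [this]; exact (abs_sub _ _).trans (by linarith)
      have hn : (0 : ℝ) ≤ 2 * n * ε := by positivity
      have hTn : 0 ≤ |T - T'| := abs_nonneg _
      push_cast
      rcases lt_trichotomy t r.toReal with htr | htr | htr
      · have hlt : t * (s.toReal / r.toReal) < s.toReal := by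
          rw [← mul_div_assoc, div_lt_iff₀ r0, mul_comm]
          exact mul_lt_mul_of_pos_left htr s0
        simp only [htr.le, if_true, htr, hlt]
        refine ⟨?_, levyProkhorov_conf_le x y c1⟩
        have : t * (s.toReal / r.toReal) - t = (t / r.toReal) * (s.toReal - r.toReal) := by
          field_simp
        rw [this, abs_mul, abs_of_nonneg (by positivity)]
        have h1 : t / r.toReal ≤ 1 := (div_le_one r0).2 htr.le
        have := mul_le_of_le_one_left (abs_nonneg (s.toReal - r.toReal)) h1
        linarith
      · subst htr
        have e : r.toReal * (s.toReal / r.toReal) = s.toReal := by field_simp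
        have := hl 0 le_rfl (sub_nonneg.2 rT)
        rw [l0] at this
        simp only [le_refl, if_true, e, lt_irrefl, if_false, sub_self]
        exact ⟨by linarith, this.2⟩
      · have h1 := hl (t - r.toReal) (by linarith) (by linarith)
        have h2 : 0 ≤ l (t - r.toReal) := by
          rw [← l0]; exact lm.monotone (by linarith)
        have h3 : ¬ (l (t - r.toReal) + s.toReal < s.toReal) := by linarith
        simp only [not_le.2 htr, not_lt.2 htr.le, if_false, h3, add_sub_cancel_right]
        refine ⟨?_, h1.2⟩
        have : l (t - r.toReal) + s.toReal - t =
            (l (t - r.toReal) - (t - r.toReal)) + (s.toReal - r.toReal) := by ring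
        rw [this]
        refine (abs_add_le _ _).trans ?_
        linarith [h1.1]

theorem edist_pathMap_le {ε : ℝ} (hε : 0 < ε) (n : ℕ) (ω ω' : oneSet S T n)
    (hc : Close ε n ω.1.1 ω.1.2 ω'.1.1 ω'.1.2)
    (hiff : ω.1.2.total n = T ↔ ω'.1.2.total n = T) :
    edist (pathMap S T n ω) (pathMap S T n ω') ≤ ENNReal.ofReal ((2 * n + 1) * ε) := by
  obtain ⟨-, hp, ht⟩ := (isOneTraj_iff ω.1.1 ω.1.2).1 ω.2
  obtain ⟨-, kp, kt⟩ := (isOneTraj_iff ω'.1.1 ω'.1.2).1 ω'.2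
  have hT : ENNReal.ofReal T = T := ENNReal.ofReal_coe_nnreal
  obtain ⟨l, lm, lc, l0, lT, hl⟩ := exists_timeChange hε n _ _ _ _ hc hp kp T T T.2 T.2
    (by rwa [hT]) (by rwa [hT]) (by rwa [hT])
  have hmaps : ∀ t : Set.Icc (0 : ℝ) T, l t ∈ Set.Icc (0 : ℝ) T := fun t =>
    ⟨l0.ge.trans (lm.monotone t.2.1),
      (lm.monotone t.2.2).trans lT.le⟩
  let L : Set.Icc (0 : ℝ) T → Set.Icc (0 : ℝ) T := fun t => ⟨l t, hmaps t⟩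
  have Lm : StrictMono L := fun a b hab => lm hab
  have Ls : Function.Surjective L := by
    intro t
    have : (t : ℝ) ∈ Set.Icc (l 0) (l T) := by rw [l0, lT]; exact t.2
    obtain ⟨u, hu, hut⟩ := intermediate_value_Icc T.2 lc.continuousOn this
    exact ⟨⟨u, hu⟩, Subtype.ext hut⟩
  refine iInf_le_of_le (Lm.orderIsoOfSurjective L Ls) (max_le ?_ ?_)
  · refine iSup_le fun t => ?_
    have := (hl t t.2.1 t.2.2).1
    rw [edist_dist]
    refine ENNReal.ofReal_le_ofReal ?_
    rw [Subtype.dist_eq, Real.dist_eq]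
    refine this.trans ?_
    simp only [sub_self, abs_zero, add_zero]
    nlinarith
  · refine iSup_le fun t => (hl t t.2.1 t.2.2).2.trans ?_
    refine ENNReal.ofReal_le_ofReal ?_
    have : (0 : ℝ) ≤ 2 * n * ε := by positivity
    nlinarith

/-- The path is a measurable function of the history, for the Borel sigma-algebra of the `J_1`
topology. -/
theorem measurable_pathMap (n : ℕ) : Measurable (pathMap S T n) := by
  have cont : ∀ A : Set (oneSet S T n),
      (∀ ω ∈ A, ∀ ω' ∈ A, (ω.1.2.total n = T ↔ ω'.1.2.total n = T)) →
      Continuous fun a : A => pathMap S T n a := by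
    intro A hA
    rw [continuous_iff_continuousAt]
    intro ω'
    rw [ContinuousAt, EMetric.tendsto_nhds]
    intro ε hε
    obtain ⟨δ, hδ, hδε⟩ : ∃ δ : ℝ, 0 < δ ∧ ENNReal.ofReal ((2 * n + 1) * δ) < ε := by
      obtain ⟨r, hr, hr'⟩ := ENNReal.lt_iff_exists_nnreal_btwn.1 hε
      have hr0 : (0 : ℝ) < r := by exact_mod_cast hr
      refine ⟨r / (2 * n + 1), by positivity, ?_⟩
      rw [mul_div_cancel₀ _ (by positivity)]
      simpa using hr'
    have hfin : ω'.1.1.2.total n ≠ ∞ := ne_top_of_le_ne_top ENNReal.coe_ne_top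
      ((isOneTraj_iff ω'.1.1.1 ω'.1.1.2).1 ω'.1.2).2.2
    have hc : Continuous fun a : A => a.1.1 := continuous_subtype_val.comp continuous_subtype_val
    filter_upwards [hc.continuousAt.eventually
      (eventually_close hδ n ω'.1.1.1 ω'.1.1.2 hfin)] with ω hω
    exact (edist_pathMap_le hδ n _ _ hω (hA _ ω.2 _ ω'.2)).trans_lt hδε
  have hm : MeasurableSet {ω : oneSet S T n | ω.1.2.total n = T} :=
    ((Hist.measurable_total n).comp (measurable_snd.comp measurable_subtype_coe))
      (measurableSet_singleton _)
  refine measurable_of_measurable_union_cover _ _ hm hm.compl (by simp) ?_ ?_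
  · exact (cont _ fun ω h ω' h' => iff_of_true h h').measurable
  · exact (cont _ fun ω h ω' h' => iff_of_false h h').measurable

end PathMeasurable

/-- A coagulation kernel `K` (measurable and symmetric) and a placement kernel `Υ` (a symmetric Markov
kernel). -/
structure Model (S : Type u) [MeasurableSpace S] where
  K : Particle S → Particle S → ℝ≥0
  measurable_K : Measurable (Function.uncurry K)
  symm_K : ∀ y y', K y y' = K y' y
  Υ : Kernel (Particle S × Particle S) S
  markov_Υ : IsMarkovKernel Υ
  symm_Υ : ∀ y y', Υ (y, y') = Υ (y', y)

attribute [instance] Model.markov_Υ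

/-- The exponential distribution with rate `r`; for `r = 0` the waiting time is `∞`. -/
noncomputable def hold : Kernel ℝ≥0 ℝ≥0∞ where
  toFun r := open Classical in
    if r = 0 then Measure.dirac ∞ else (expMeasure r).map ENNReal.ofReal
  measurable' := by
    classical
    refine Measurable.ite (measurableSet_singleton (0 : ℝ≥0)) measurable_const ?_
    refine Measure.measurable_of_measurable_coe _ fun B hB => ?_
    have hB' := ENNReal.measurable_ofReal hB
    have : (fun r : ℝ≥0 => (expMeasure (r : ℝ)).map ENNReal.ofReal B) = fun r : ℝ≥0 =>
        ∫⁻ s in ENNReal.ofReal ⁻¹' B,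
          ENNReal.ofReal (if 0 ≤ s then (r : ℝ) * Real.exp (-(r * s)) else 0) := by
      funext r
      rw [Measure.map_apply ENNReal.measurable_ofReal hB, expMeasure, gammaMeasure,
        withDensity_apply _ hB']
      exact lintegral_congr fun s => exponentialPDF_eq r s
    rw [this]
    refine Measurable.lintegral_prod_right' (f := fun a : ℝ≥0 × ℝ =>
      ENNReal.ofReal (if 0 ≤ a.2 then (a.1 : ℝ) * Real.exp (-(a.1 * a.2)) else 0)) ?_
    refine ENNReal.measurable_ofReal.comp (Measurable.ite
      (measurableSet_le measurable_const measurable_snd) ?_ measurable_const)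
    fun_prop

instance : IsMarkovKernel hold where
  isProbabilityMeasure r := by
    change IsProbabilityMeasure (ite _ _ _)
    split_ifs with h
    · infer_instance
    · have := isProbabilityMeasure_expMeasure (r := r) (by positivity)
      exact Measure.isProbabilityMeasure_map ENNReal.measurable_ofReal.aemeasurable

/-- Lebesgue measure on `[0, ∞)`, as a measure on `[0, ∞]`. -/
noncomputable def lebesgue : Measure ℝ≥0∞ :=
  (volume.restrict (Set.Ici (0 : ℝ))).map ENNReal.ofReal

instance : SFinite lebesgue := by unfold lebesgue; infer_instance

section Dynamics

variable {S : Type u} [MeasurableSpace S] (m : Model S)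

/-- The same model with `K` replaced by `K / N`. -/
noncomputable def Model.scale (N : ℕ) : Model S where
  K y y' := m.K y y' / N
  measurable_K := m.measurable_K.div_const _
  symm_K y y' := by rw [m.symm_K]
  Υ := m.Υ
  markov_Υ := m.markov_Υ
  symm_Υ := m.symm_Υ

/-- The number `H = sup ⟨v, K w⟩` over all measures `v`, `w` on `S × ℕ` with `‖v‖_1, ‖w‖_1 ≤ 1`, where
`‖v‖_1 = ∫ m v(d(x, m))`. Such measures are finite, as masses are at least one. -/
noncomputable def Model.H : ℝ≥0∞ :=
  ⨆ (v : Measure (Particle S)) (w : Measure (Particle S))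
    (_ : ∫⁻ y, (y.2 : ℝ≥0∞) ∂v ≤ 1) (_ : ∫⁻ y, (y.2 : ℝ≥0∞) ∂w ≤ 1),
    ∫⁻ y, ∫⁻ y', m.K y y' ∂w ∂v

/-- The coagulation rate of a pair of particles. -/
def Model.pairRate {n : ℕ} (x : Fin n → Particle S) (p : Pair n) : ℝ≥0 :=
  m.K (x p.1.1) (x p.1.2)

/-- The total coagulation rate of a system: the sum over all unordered pairs of particles. -/
def Model.totalRate {n : ℕ} (x : Fin n → Particle S) : ℝ≥0 := ∑ p : Pair n, m.pairRate x p

theorem Model.measurable_pairRate {n : ℕ} (p : Pair n) :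
    Measurable fun x : Fin n → Particle S => m.pairRate x p :=
  Measurable.comp (g := Function.uncurry m.K) (f := fun x : Fin n → Particle S => (x p.1.1, x p.1.2)) m.measurable_K
    ((measurable_pi_apply p.1.1).prodMk (measurable_pi_apply p.1.2))

theorem Model.measurable_totalRate (n : ℕ) :
    Measurable (m.totalRate : (Fin n → Particle S) → ℝ≥0) :=
  Finset.measurable_sum _ fun p _ => m.measurable_pairRate p

/-- The coagulation rates of a system, as a measure on pairs and new sites: the sum over all unordered
pairs of particles of `K(y, y') Υ(y, y', dz)`. -/
noncomputable def Model.rate (n : ℕ) : Kernel (Fin n → Particle S) (Pair n × S) where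
  toFun x := ∑ p : Pair n, m.pairRate x p • (m.Υ (x p.1.1, x p.1.2)).map (Prod.mk p)
  measurable' := by
    refine Measure.measurable_of_measurable_coe _ fun B hB => ?_
    simp only [Measure.finsetSum_apply, Measure.smul_apply]
    refine Finset.measurable_sum _ fun p _ => ?_
    simp_rw [Measure.map_apply measurable_prodMk_left hB]
    refine (m.measurable_pairRate p).smul ?_
    exact (Kernel.measurable_coe m.Υ (measurable_prodMk_left hB)).comp
      ((measurable_pi_apply p.1.1).prodMk (measurable_pi_apply p.1.2))

theorem Model.rate_apply (n : ℕ) (x : Fin n → Particle S) :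
    m.rate n x = ∑ p : Pair n, m.pairRate x p • (m.Υ (x p.1.1, x p.1.2)).map (Prod.mk p) := rfl

theorem Model.rate_univ (n : ℕ) (x : Fin n → Particle S) :
    m.rate n x Set.univ = m.totalRate x := by
  rw [Model.rate_apply, Measure.finsetSum_apply]
  rw [Model.totalRate, ENNReal.ofNNReal_finsetSum]
  refine Finset.sum_congr rfl fun p _ => ?_
  rw [Measure.smul_apply, Measure.map_apply measurable_prodMk_left MeasurableSet.univ,
    Set.preimage_univ, measure_univ, ENNReal.smul_def, smul_eq_mul, mul_one]

instance (n : ℕ) : IsSFiniteKernel (m.rate n) := by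
  have : m.rate n = ∑ p : Pair n, Kernel.withDensity
      ((m.Υ.comap (fun x : Fin n → Particle S => (x p.1.1, x p.1.2))
        ((measurable_pi_apply p.1.1).prodMk (measurable_pi_apply p.1.2))).map (Prod.mk p))
      (fun x _ => (m.pairRate x p : ℝ≥0∞)) := by
    ext x : 1
    rw [Model.rate_apply, _root_.sum_apply]
    refine Finset.sum_congr rfl fun p _ => ?_
    have hm : Measurable (Function.uncurry fun (x : Fin n → Particle S) (_ : Pair n × S) =>
        (m.pairRate x p : ℝ≥0∞)) :=
      (measurable_coe_nnreal_ennreal.comp (m.measurable_pairRate p)).comp measurable_fst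
    rw [Kernel.withDensity_apply _ hm, withDensity_const, Kernel.map_apply _ measurable_prodMk_left, Kernel.comap_apply]
    rfl
  rw [this]
  exact Kernel.IsSFiniteKernel.finsetSum _ fun p _ => inferInstance

/-- A dummy pair, for systems whose total rate is zero. -/
def firstPair (n : ℕ) : Pair (n + 2) := ⟨(0, 1), by simp⟩

/-- The law of the coagulating pair and of the new site: the normalised rates. (If the total rate is
zero, the waiting time is `∞` and this choice is irrelevant.) -/
noncomputable def Model.choice (n : ℕ) :
    Kernel (Fin (n + 2) → Particle S) (Pair (n + 2) × S) where
  toFun x := open Classical in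
    if m.totalRate x = 0 then Measure.dirac (firstPair n, (x 0).1)
    else (m.totalRate x)⁻¹ • m.rate (n + 2) x
  measurable' := by
    classical
    refine Measurable.ite (m.measurable_totalRate _ (measurableSet_singleton _)) ?_ ?_
    · exact Measure.measurable_dirac.comp
        (measurable_const.prodMk (measurable_pi_apply 0).fst)
    · refine Measure.measurable_of_measurable_coe _ fun B hB => ?_
      exact ((m.measurable_totalRate _).inv).smul (Kernel.measurable_coe _ hB)

instance (n : ℕ) : IsMarkovKernel (m.choice n) where
  isProbabilityMeasure x := by
    change IsProbabilityMeasure (ite _ _ _)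
    split_ifs with h
    · infer_instance
    · constructor
      rw [Measure.smul_apply, Model.rate_univ, ENNReal.smul_def, smul_eq_mul,
        ← ENNReal.coe_mul, inv_mul_cancel₀ h, ENNReal.coe_one]

/-- One step of the Markov jump process: the coagulation chosen by the normalised rates, and
independently the exponential waiting time whose parameter is the total rate. -/
noncomputable def Model.step (n : ℕ) :
    Kernel (Fin (n + 2) → Particle S) ((Pair (n + 2) × S) × ℝ≥0∞) :=
  m.choice n ×ₖ hold.comap m.totalRate (m.measurable_totalRate _)

/-- The product of the (unnormalised) coagulation rates and Lebesgue measure for the waiting time. -/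
noncomputable def Model.stepRate (n : ℕ) :
    Kernel (Fin (n + 2) → Particle S) ((Pair (n + 2) × S) × ℝ≥0∞) :=
  m.rate (n + 2) ×ₖ Kernel.const _ lebesgue

theorem measurable_merge (n : ℕ) : Measurable
    fun a : (Fin (n + 2) → Particle S) × ((Pair (n + 2) × S) × ℝ≥0∞) =>
      merge a.1 a.2.1.1 a.2.1.2 := by
  have h : ∀ p : Pair (n + 2), Measurable
      fun a : (Fin (n + 2) → Particle S) × S => merge a.1 p a.2 := by
    intro p
    refine measurable_pi_lambda _ fun l => ?_
    unfold merge
    by_cases hl : p.1.2.succAbove l = p.1.1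
    · simp only [hl, Function.update_self]
      refine measurable_snd.prodMk ?_
      exact (Measurable.of_discrete (f := fun a : ℕ+ × ℕ+ => a.1 + a.2)).comp
        (((measurable_pi_apply p.1.1).comp measurable_fst).snd.prodMk
          ((measurable_pi_apply p.1.2).comp measurable_fst).snd)
    · simp only [Function.update_of_ne hl]
      exact (measurable_pi_apply _).comp measurable_fst
  have h' : Measurable fun b : Pair (n + 2) × ((Fin (n + 2) → Particle S) × S) =>
      merge b.2.1 b.1 b.2.2 := measurable_from_prod_countable_right h
  exact h'.comp (measurable_snd.fst.fst.prodMk (measurable_fst.prodMk measurable_snd.fst.snd))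

/-- Iteration of a step kernel: first one step, then the remaining history of the merged system. -/
noncomputable def iterKernel
    (κ : (n : ℕ) → Kernel (Fin (n + 2) → Particle S) ((Pair (n + 2) × S) × ℝ≥0∞)) :
    (n : ℕ) → Kernel (Fin (n + 1) → Particle S) (Hist S n)
  | 0 => Kernel.const _ (Measure.dirac PUnit.unit)
  | n + 1 => κ n ⊗ₖ (iterKernel κ n).comap (fun a => merge a.1 a.2.1.1 a.2.1.2)
      (measurable_merge n)

/-- The law of the whole history of the Marcus-Lushnikov process: the Markov jump process in which each
unordered pair of particles coagulates at rate `K`, the new particle being placed by `Υ`. -/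
noncomputable def Model.histLaw (n : ℕ) : Kernel (Fin (n + 1) → Particle S) (Hist S n) :=
  iterKernel m.step n

/-- The product of the successive coagulation rates times Lebesgue measure on all waiting times. -/
noncomputable def Model.histRate (n : ℕ) : Kernel (Fin (n + 1) → Particle S) (Hist S n) :=
  iterKernel m.stepRate n

instance (n : ℕ) : IsMarkovKernel (m.step n) := by unfold Model.step; infer_instance

instance (n : ℕ) : IsSFiniteKernel (m.stepRate n) := by unfold Model.stepRate; infer_instance

instance instMarkovHistLaw : (n : ℕ) → IsMarkovKernel (m.histLaw n)
  | 0 => inferInstanceAs (IsMarkovKernel (Kernel.const _ (Measure.dirac PUnit.unit)))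
  | n + 1 => by
    have := instMarkovHistLaw n
    exact inferInstanceAs (IsMarkovKernel (m.step n ⊗ₖ (m.histLaw n).comap _
      (measurable_merge n)))

instance instSFiniteHistRate : (n : ℕ) → IsSFiniteKernel (m.histRate n)
  | 0 => inferInstanceAs (IsSFiniteKernel (Kernel.const _ (Measure.dirac PUnit.unit)))
  | n + 1 => by
    have := instSFiniteHistRate n
    exact inferInstanceAs (IsSFiniteKernel (m.stepRate n ⊗ₖ (m.histRate n).comap _
      (measurable_merge n)))

end Dynamics

section Laws

/-- Finite families of sites: the vectors `(x_1, ..., x_n)` of initial atoms. -/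
abbrev Atoms (S : Type u) : Type u := Σ n : ℕ, Fin n → S

variable {S : Type u} [MetricSpace S] [SecondCountableTopology S] [MeasurableSpace S]
  [BorelSpace S]

/-- The point measure `k = ∑ δ_{x_i}` of a vector of atoms. -/
def Atoms.config {S : Type u} (k : Atoms S) : Multiset S := Finset.univ.val.map k.2

/-- The image of a kernel on histories under the path map, after restriction to the event
`{Ξ ∈ Γ_T^(1)}`. -/
noncomputable def onOneTraj (T : ℝ≥0) {n : ℕ}
    (κ : Kernel (Fin (n + 1) → Particle S) (Hist S n)) :
    Kernel (Fin (n + 1) → Particle S) (OneTraj S T) :=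
  ((Kernel.id ×ₖ κ).comapRight
    (MeasurableEmbedding.subtype_coe (measurableSet_oneSet T n))).map (pathMap S T n)

/-- The same for initial atoms of mass one; with no atoms the path is the empty configuration, which is
not in `Γ_T^(1)`, and the restricted measure is zero. -/
noncomputable def fromAtoms (T : ℝ≥0)
    (κ : (n : ℕ) → Kernel (Fin (n + 1) → Particle S) (Hist S n)) :
    Kernel (Atoms S) (OneTraj S T) where
  toFun
    | ⟨0, _⟩ => 0
    | ⟨n + 1, x⟩ => onOneTraj T (κ n) fun i => (x i, 1)
  measurable' := by
    intro B hB
    rw [MeasurableSpace.measurableSet_iInf]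
    rintro (_ | n)
    · exact (measurable_const :
        Measurable fun _ : Fin 0 → S => (0 : Measure (OneTraj S T))) hB
    · exact ((onOneTraj T (κ n)).measurable.comp
        (measurable_pi_lambda _ fun i => (measurable_pi_apply i).prodMk measurable_const)) hB

/-- The restriction to `Γ_T^(1)` of the law `P_k(Ξ ∈ ·)` of the process on `[0, T]`. -/
noncomputable def Model.P (m : Model S) (T : ℝ≥0) : Kernel (Atoms S) (OneTraj S T) :=
  fromAtoms T m.histLaw

/-- The measure `Q_k^(T)`: the product of the coagulation rates times Lebesgue measure on the
inter-coagulation times, transported to `Γ_T^(1)`. -/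
noncomputable def Model.Q (m : Model S) (T : ℝ≥0) : Kernel (Atoms S) (OneTraj S T) :=
  fromAtoms T m.histRate

/-- The law of a Poisson point process with finite intensity measure `μ`: the number of points is
Poisson with parameter `μ(S)` and given it the points are i.i.d., that is,
`e^(-μ(S)) ∑_n μ^(⊗ n) / n!`. -/
noncomputable def poi (μ : Measure S) : Measure (Atoms S) :=
  Measure.sum fun n =>
    (ENNReal.ofReal (Real.exp (-μ.real Set.univ)) / (n.factorial : ℝ≥0∞)) •
      (Measure.pi fun _ : Fin n => μ).map (Sigma.mk n)

/-- The reference measure `M_{μ,N}^(T)(dξ) = N^(|ξ_0| - 1) e P_{Poi_μ}(Ξ ∈ dξ)` on `Γ_T^(1)`, for the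
kernel `K / N`. -/
noncomputable def Model.refN (m : Model S) (μ : Measure S) (T : ℝ≥0) (N : ℕ) :
    Measure (OneTraj S T) :=
  (ENNReal.ofReal (Real.exp 1) • ((m.scale N).P T ∘ₘ poi μ)).withDensity
    fun ξ => (N : ℝ≥0∞) ^ (ξ.atoms - 1)

/-- The measure `M_μ^(T) = e Poi_μ ⊗ Q^(T)` on `Γ_T^(1)`. -/
noncomputable def Model.ref (m : Model S) (μ : Measure S) (T : ℝ≥0) : Measure (OneTraj S T) :=
  ENNReal.ofReal (Real.exp 1) • (m.Q T ∘ₘ poi μ)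

end Laws

end Coag

/-! On the event that every coagulation happens, the law of the process has an explicit density. If
the current total rate is `R`, the next pair and site have law `rate / R` and the waiting time has
density `R * exp (-R s)`. The two factors `R` cancel, leaving the unnormalised rates times Lebesgue
measure, weighted by `exp (-R s)`. Iterating over the coagulations, the law of the history equals
`histRate` with density `exp (-action)`, where `action` is the time integral of the total rate up to
the last coagulation; the single particle left after that has rate zero (`Model.lintegral_histLaw`).

Replacing `K` by `K / N` divides each of the `|k| - 1` rate factors by `N` and divides the action by
`N`. Hence `N ^ (|k| - 1)` times the restricted law has density `exp (-action / N)` relative to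
`Q_k`, and this density increases to 1 as `N → ∞`. Monotone convergence gives convergence of the
integral of every nonnegative measurable function of the path, which is more than weak convergence.
Since the convergence is monotone for each `k`, a second use of monotone convergence under the
Poisson integral gives the limit of `M_{μ,N}`, also when it is infinite
(`Model.tendsto_lintegral_refN`).

Three further facts are needed. `Q_k` is finite: testing the supremum `H` on normalised Dirac masses
gives `K(y, y') ≤ H m m'`, so by conservation of mass the total rate never exceeds `H |k|^2`, and
`Q_k` has mass at most `(H |k|^2 T) ^ (|k| - 1)`. `M_{μ,N}` is finite: sub-probability measures
weighted by `N ^ (|k| - 1)` are summable against the Poisson weights. Neither measure depends on the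
enumeration of the atoms: a permutation of the labels acts on histories without changing the path,
and `K` and `Υ` are symmetric. -/

namespace Coag

/-! ### Density of the law of the history relative to rates times Lebesgue measure, and its scaling
in `N`. -/

section Integrals

variable {S : Type*} [MeasurableSpace S] (m : Model S)

theorem lintegral_lebesgue {φ : ℝ≥0∞ → ℝ≥0∞} (hφ : Measurable φ) :
    ∫⁻ s, φ s ∂lebesgue = ∫⁻ s in Set.Ici (0 : ℝ), φ (ENNReal.ofReal s) := by
  rw [lebesgue, lintegral_map hφ ENNReal.measurable_ofReal]

theorem lebesgue_Iic (t : ℝ≥0) : lebesgue (Set.Iic (t : ℝ≥0∞)) = t := by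
  rw [lebesgue, Measure.map_apply ENNReal.measurable_ofReal measurableSet_Iic,
    Measure.restrict_apply (ENNReal.measurable_ofReal measurableSet_Iic)]
  have : ENNReal.ofReal ⁻¹' Set.Iic (t : ℝ≥0∞) ∩ Set.Ici 0 = Set.Icc (0 : ℝ) t := by
    ext s
    simp only [Set.mem_inter_iff, Set.mem_preimage, Set.mem_Iic, Set.mem_Ici, Set.mem_Icc]
    rw [and_comm, ← ENNReal.ofReal_coe_nnreal, ENNReal.ofReal_le_ofReal_iff t.coe_nonneg]
  rw [this]
  simp

/-- The factor `r` of the exponential density is kept apart so that it can cancel against the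
normalisation of the rates. The value of the weight at `∞` plays no role, since `lebesgue` lives on
finite times. -/
theorem lintegral_hold {r : ℝ≥0} (hr : r ≠ 0) {φ : ℝ≥0∞ → ℝ≥0∞} (hφ : Measurable φ) :
    ∫⁻ s, φ s ∂hold r =
      r * ∫⁻ s, φ s * ENNReal.ofReal (Real.exp (-(r * s.toReal))) ∂lebesgue := by
  have h : hold r = (expMeasure r).map ENNReal.ofReal := if_neg hr
  have hφ' : Measurable fun s : ℝ => φ (ENNReal.ofReal s) := hφ.comp ENNReal.measurable_ofReal
  have hd : Measurable (exponentialPDF r) := by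
    simp only [funext (exponentialPDF_eq (r : ℝ))]
    exact ENNReal.measurable_ofReal.comp (Measurable.ite measurableSet_Ici (by fun_prop)
      measurable_const)
  have he : expMeasure r = volume.withDensity (exponentialPDF r) := rfl
  rw [h, lintegral_map hφ ENNReal.measurable_ofReal, he,
    lintegral_withDensity_eq_lintegral_mul _ hd hφ',
    lintegral_lebesgue (by fun_prop), ← lintegral_const_mul _ (by fun_prop),
    ← lintegral_indicator measurableSet_Ici]
  refine lintegral_congr fun s => ?_
  rw [Pi.mul_apply, exponentialPDF_eq]
  by_cases hs : 0 ≤ s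
  · rw [if_pos hs, Set.indicator_of_mem (Set.mem_Ici.2 hs), ENNReal.toReal_ofReal hs,
      ENNReal.ofReal_mul r.coe_nonneg, ENNReal.ofReal_coe_nnreal]
    ring
  · rw [if_neg hs, Set.indicator_of_notMem (by simpa using hs), ENNReal.ofReal_zero, zero_mul]

theorem Model.lintegral_rate (n : ℕ) (x : Fin n → Particle S) {f : Pair n × S → ℝ≥0∞}
    (hf : Measurable f) :
    ∫⁻ b, f b ∂m.rate n x =
      ∑ p : Pair n, (m.pairRate x p : ℝ≥0∞) * ∫⁻ z, f (p, z) ∂m.Υ (x p.1.1, x p.1.2) := by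
  rw [Model.rate_apply, lintegral_finsetSum_measure]
  refine Finset.sum_congr rfl fun p _ => ?_
  rw [lintegral_smul_measure, lintegral_map hf measurable_prodMk_left]
  rfl

theorem Model.lintegral_stepRate (n : ℕ) (x : Fin (n + 2) → Particle S)
    {g : (Pair (n + 2) × S) × ℝ≥0∞ → ℝ≥0∞} (hg : Measurable g) :
    ∫⁻ a, g a ∂m.stepRate n x = ∫⁻ b, ∫⁻ s, g (b, s) ∂lebesgue ∂m.rate (n + 2) x := by
  rw [Model.stepRate, Kernel.lintegral_prod _ _ _ hg]
  simp

/-- On finite waiting times, the exponential clock has density `exp (-R s)` relative to rates times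
Lebesgue measure. -/
theorem Model.lintegral_step (n : ℕ) (x : Fin (n + 2) → Particle S)
    {g : (Pair (n + 2) × S) × ℝ≥0∞ → ℝ≥0∞} (hg : Measurable g) (h0 : ∀ b, g (b, ∞) = 0) :
    ∫⁻ a, g a ∂m.step n x =
      ∫⁻ a, g a * ENNReal.ofReal (Real.exp (-(m.totalRate x * a.2.toReal))) ∂m.stepRate n x := by
  rw [m.lintegral_stepRate n x (by fun_prop), Model.step, Kernel.lintegral_prod _ _ _ hg]
  simp only [Kernel.comap_apply]
  -- If the total rate is zero, both sides vanish: the rate measure is zero, and the clock sits at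
  -- `∞`, where `g` is zero. The dummy value of `choice` is therefore never seen.
  by_cases hR : m.totalRate x = 0
  · have hz : m.rate (n + 2) x = 0 := by
      rw [← Measure.measure_univ_eq_zero, m.rate_univ, hR, ENNReal.coe_zero]
    have hh : hold (m.totalRate x) = Measure.dirac ∞ := if_pos hR
    rw [hz, lintegral_zero_measure, hh]
    have : ∀ b, ∫⁻ s, g (b, s) ∂Measure.dirac (∞ : ℝ≥0∞) = 0 := fun b => by
      rw [lintegral_dirac' _ (by fun_prop), h0]
    simp only [this, lintegral_zero]
  · have hc : m.choice n x = (m.totalRate x)⁻¹ • m.rate (n + 2) x := if_neg hR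
    have hi : ∀ b, ∫⁻ s, g (b, s) ∂hold (m.totalRate x) = m.totalRate x *
        ∫⁻ s, g (b, s) * ENNReal.ofReal (Real.exp (-(m.totalRate x * s.toReal))) ∂lebesgue :=
      fun b => lintegral_hold hR (by fun_prop)
    simp only [hi]
    have hm : Measurable fun b : Pair (n + 2) × S => ∫⁻ s, g (b, s) *
        ENNReal.ofReal (Real.exp (-(m.totalRate x * s.toReal))) ∂lebesgue := by
      refine Measurable.lintegral_prod_right' (f := fun a : (Pair (n + 2) × S) × ℝ≥0∞ =>
        g a * ENNReal.ofReal (Real.exp (-(m.totalRate x * a.2.toReal)))) ?_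
      fun_prop
    -- The rate `R` of the clock cancels the normalisation `R⁻¹` of the choice of the pair.
    rw [lintegral_const_mul _ hm, hc, lintegral_smul_measure, ENNReal.smul_def, smul_eq_mul,
      ← mul_assoc, ← ENNReal.coe_mul, mul_inv_cancel₀ hR, ENNReal.coe_one, one_mul]

theorem lintegral_iterKernel_succ
    (κ : (n : ℕ) → Kernel (Fin (n + 2) → Particle S) ((Pair (n + 2) × S) × ℝ≥0∞))
    (n : ℕ) [IsSFiniteKernel (κ n)] [IsSFiniteKernel (iterKernel κ n)]
    (x : Fin (n + 2) → Particle S) {F : Hist S (n + 1) → ℝ≥0∞} (hF : Measurable F) :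
    ∫⁻ h, F h ∂iterKernel κ (n + 1) x =
      ∫⁻ a, ∫⁻ h, F (a, h) ∂iterKernel κ n (merge x a.1.1 a.1.2) ∂κ n x := by
  have h := Kernel.lintegral_compProd (κ n) ((iterKernel κ n).comap
    (fun a => merge a.1 a.2.1.1 a.2.1.2) (measurable_merge n)) x (f := F) hF
  simp only [Kernel.comap_apply] at h
  exact h

theorem Model.lintegral_histLaw_succ (n : ℕ) (x : Fin (n + 2) → Particle S)
    {F : Hist S (n + 1) → ℝ≥0∞} (hF : Measurable F) :
    ∫⁻ h, F h ∂m.histLaw (n + 1) x =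
      ∫⁻ a, ∫⁻ h, F (a, h) ∂m.histLaw n (merge x a.1.1 a.1.2) ∂m.step n x :=
  have : IsSFiniteKernel (iterKernel m.step n) := inferInstanceAs (IsSFiniteKernel (m.histLaw n))
  lintegral_iterKernel_succ m.step n x hF

theorem Model.lintegral_histRate_succ (n : ℕ) (x : Fin (n + 2) → Particle S)
    {F : Hist S (n + 1) → ℝ≥0∞} (hF : Measurable F) :
    ∫⁻ h, F h ∂m.histRate (n + 1) x =
      ∫⁻ a, ∫⁻ h, F (a, h) ∂m.histRate n (merge x a.1.1 a.1.2) ∂m.stepRate n x :=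
  have : IsSFiniteKernel (iterKernel m.stepRate n) :=
    inferInstanceAs (IsSFiniteKernel (m.histRate n))
  lintegral_iterKernel_succ m.stepRate n x hF

theorem Model.lintegral_histLaw_zero (x : Fin 1 → Particle S) (F : Hist S 0 → ℝ≥0∞) :
    ∫⁻ h, F h ∂m.histLaw 0 x = F PUnit.unit := by
  change ∫⁻ h : PUnit, F h ∂Measure.dirac PUnit.unit = _
  exact lintegral_dirac' _ (measurable_from_top)

theorem Model.lintegral_histRate_zero (x : Fin 1 → Particle S) (F : Hist S 0 → ℝ≥0∞) :
    ∫⁻ h, F h ∂m.histRate 0 x = F PUnit.unit :=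
  m.lintegral_histLaw_zero x F

/-- The integral over time of the total coagulation rate, up to the last coagulation. -/
noncomputable def Model.action : (n : ℕ) → (Fin (n + 1) → Particle S) → Hist S n → ℝ
  | 0, _, _ => 0
  | n + 1, x, (((p, z), s), h) => m.totalRate x * s.toReal + Model.action n (merge x p z) h

theorem Model.action_nonneg (n : ℕ) (x : Fin (n + 1) → Particle S) (h : Hist S n) :
    0 ≤ m.action n x h := by
  induction n with
  | zero => exact le_rfl
  | succ n ih =>
    obtain ⟨⟨⟨p, z⟩, s⟩, h⟩ := h
    have := ih (merge x p z) h
    simp only [Model.action]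
    positivity

theorem Model.measurable_action (n : ℕ) :
    Measurable fun ω : (Fin (n + 1) → Particle S) × Hist S n => m.action n ω.1 ω.2 := by
  induction n with
  | zero => exact measurable_const
  | succ n ih =>
    have h1 : Measurable fun ω : (Fin (n + 2) → Particle S) ×
        (((Pair (n + 2) × S) × ℝ≥0∞) × Hist S n) => (m.totalRate ω.1 : ℝ) * ω.2.1.2.toReal :=
      ((m.measurable_totalRate _).coe_nnreal_real.comp measurable_fst).mul
        (measurable_snd.fst.snd.ennreal_toReal)
    have h2 : Measurable fun ω : (Fin (n + 2) → Particle S) ×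
        (((Pair (n + 2) × S) × ℝ≥0∞) × Hist S n) => (merge ω.1 ω.2.1.1.1 ω.2.1.1.2, ω.2.2) :=
      ((measurable_merge n).comp (measurable_fst.prodMk measurable_snd.fst)).prodMk
        measurable_snd.snd
    exact h1.add (ih.comp h2)

theorem Model.measurable_action_right (n : ℕ) (x : Fin (n + 1) → Particle S) :
    Measurable (m.action n x) :=
  (m.measurable_action n).comp measurable_prodMk_left

theorem Model.measurable_lintegral_histRate_merge (n : ℕ) (x : Fin (n + 2) → Particle S)
    {F : Hist S (n + 1) → ℝ≥0∞} (hF : Measurable F) :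
    Measurable fun a : (Pair (n + 2) × S) × ℝ≥0∞ =>
      ∫⁻ h, F (a, h) ∂m.histRate n (merge x a.1.1 a.1.2) := by
  have hm : Measurable fun a : (Pair (n + 2) × S) × ℝ≥0∞ => merge x a.1.1 a.1.2 :=
    (measurable_merge n).comp measurable_prodMk_left
  exact Measurable.lintegral_kernel_prod_right' (κ := (m.histRate n).comap _ hm) hF

/-- On the event that all coagulations happen, the law of the history has density `exp (-action)`
relative to the product of the rates and Lebesgue measure. -/
theorem Model.lintegral_histLaw (n : ℕ) (x : Fin (n + 1) → Particle S) {F : Hist S n → ℝ≥0∞}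
    (hF : Measurable F) (h0 : ∀ h, h.total n = ∞ → F h = 0) :
    ∫⁻ h, F h ∂m.histLaw n x =
      ∫⁻ h, F h * ENNReal.ofReal (Real.exp (-m.action n x h)) ∂m.histRate n x := by
  induction n with
  | zero =>
    rw [m.lintegral_histLaw_zero, m.lintegral_histRate_zero]
    simp [Model.action]
  | succ n ih =>
    have hFa : ∀ a : (Pair (n + 2) × S) × ℝ≥0∞, Measurable fun h : Hist S n => F (a, h) :=
      fun a => hF.comp measurable_prodMk_left
    have hD : Measurable fun h : Hist S (n + 1) => F h *
        ENNReal.ofReal (Real.exp (-m.action n (merge x h.1.1.1 h.1.1.2) h.2)) := by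
      have hc : Measurable fun h : ((Pair (n + 2) × S) × ℝ≥0∞) × Hist S n =>
          (merge x h.1.1.1 h.1.1.2, h.2) :=
        ((measurable_merge n).comp (measurable_const.prodMk measurable_fst)).prodMk
          measurable_snd
      exact hF.mul (ENNReal.measurable_ofReal.comp (Real.measurable_exp.comp
        ((m.measurable_action n).comp hc).neg))
    have hE : Measurable fun h : Hist S (n + 1) => F h *
        ENNReal.ofReal (Real.exp (-m.action (n + 1) x h)) :=
      hF.mul (ENNReal.measurable_ofReal.comp (Real.measurable_exp.comp
        (m.measurable_action_right (n + 1) x).neg))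
    rw [m.lintegral_histLaw_succ n x hF, m.lintegral_histRate_succ n x hE]
    have h1 : ∀ a : (Pair (n + 2) × S) × ℝ≥0∞,
        ∫⁻ h, F (a, h) ∂m.histLaw n (merge x a.1.1 a.1.2) =
          ∫⁻ h, F (a, h) * ENNReal.ofReal (Real.exp (-m.action n (merge x a.1.1 a.1.2) h))
            ∂m.histRate n (merge x a.1.1 a.1.2) := fun a =>
      ih _ (hFa a) fun h hh => h0 _ (by
        obtain ⟨⟨p, z⟩, s⟩ := a
        simp only [Hist.total, hh, add_top])
    simp only [h1]
    rw [m.lintegral_step n x (m.measurable_lintegral_histRate_merge n x hD)]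
    · refine lintegral_congr fun a => ?_
      -- The weight of the first waiting time is moved inside, where it multiplies the weight of the
      -- remaining history; the exponents add up to the action.
      rw [← lintegral_mul_const' _ _ ENNReal.ofReal_ne_top]
      refine lintegral_congr fun h => ?_
      obtain ⟨⟨p, z⟩, s⟩ := a
      simp only [Model.action, neg_add, Real.exp_add, ENNReal.ofReal_mul (Real.exp_nonneg _)]
      ring
    -- An infinite first waiting time makes the total infinite, so `F` vanishes there, as the
    -- one-step formula requires.
    · intro b
      have : ∀ h : Hist S n, F ((b, ∞), h) = 0 := fun h => h0 _ (by
        obtain ⟨p, z⟩ := b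
        simp only [Hist.total, top_add])
      simp only [this, zero_mul, lintegral_zero]

theorem Model.totalRate_scale (N : ℕ) {n : ℕ} (x : Fin n → Particle S) :
    (m.scale N).totalRate x = m.totalRate x / N := by
  simp only [Model.totalRate, Model.pairRate, Model.scale, Finset.sum_div]

theorem Model.action_scale (N n : ℕ) (x : Fin (n + 1) → Particle S) (h : Hist S n) :
    (m.scale N).action n x h = m.action n x h / N := by
  induction n with
  | zero => simp [Model.action]
  | succ n ih =>
    obtain ⟨⟨⟨p, z⟩, s⟩, h⟩ := h
    simp only [Model.action, ih, m.totalRate_scale]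
    push_cast
    ring

theorem Model.lintegral_rate_scale {N : ℕ} (hN : N ≠ 0) (n : ℕ) (x : Fin n → Particle S)
    {f : Pair n × S → ℝ≥0∞} (hf : Measurable f) :
    N * ∫⁻ b, f b ∂(m.scale N).rate n x = ∫⁻ b, f b ∂m.rate n x := by
  rw [(m.scale N).lintegral_rate n x hf, m.lintegral_rate n x hf, Finset.mul_sum]
  refine Finset.sum_congr rfl fun p _ => ?_
  have : (N : ℝ≥0∞) * ((m.scale N).pairRate x p : ℝ≥0∞) = m.pairRate x p := by
    rw [← ENNReal.coe_natCast, ← ENNReal.coe_mul]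
    congr 1
    simp only [Model.pairRate, Model.scale]
    field_simp
  rw [← mul_assoc, this]
  rfl

/-- Each of the `n` coagulations carries one factor `K / N`, and Lebesgue measure on the waiting
times is not rescaled. The case `N = 0` is excluded because `K / 0 = 0`. -/
theorem Model.lintegral_histRate_scale {N : ℕ} (hN : N ≠ 0) (n : ℕ)
    (x : Fin (n + 1) → Particle S) {F : Hist S n → ℝ≥0∞} (hF : Measurable F) :
    (N : ℝ≥0∞) ^ n * ∫⁻ h, F h ∂(m.scale N).histRate n x = ∫⁻ h, F h ∂m.histRate n x := by
  induction n with
  | zero =>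
    rw [(m.scale N).lintegral_histRate_zero, m.lintegral_histRate_zero, pow_zero, one_mul]
  | succ n ih =>
    have hm' := (m.scale N).measurable_lintegral_histRate_merge n x hF
    have hm := m.measurable_lintegral_histRate_merge n x hF
    -- One factor `N` restores the rates of the first coagulation; the remaining `N ^ n` is passed
    -- inside to the induction hypothesis.
    rw [(m.scale N).lintegral_histRate_succ n x hF, m.lintegral_histRate_succ n x hF,
      (m.scale N).lintegral_stepRate n x hm', m.lintegral_stepRate n x hm, pow_succ, mul_assoc,
      m.lintegral_rate_scale hN _ x (Measurable.lintegral_prod_right' hm'),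
      ← lintegral_const_mul' _ _ (by finiteness)]
    refine lintegral_congr fun b => ?_
    rw [← lintegral_const_mul' _ _ (by finiteness)]
    refine lintegral_congr fun s => ?_
    exact ih _ (hF.comp measurable_prodMk_left)

/-- The law of the history for `K / N`, rescaled by the number of coagulations. -/
theorem Model.lintegral_histLaw_scale {N : ℕ} (hN : N ≠ 0) (n : ℕ)
    (x : Fin (n + 1) → Particle S) {F : Hist S n → ℝ≥0∞}
    (hF : Measurable F) (h0 : ∀ h, h.total n = ∞ → F h = 0) :
    (N : ℝ≥0∞) ^ n * ∫⁻ h, F h ∂(m.scale N).histLaw n x =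
      ∫⁻ h, F h * ENNReal.ofReal (Real.exp (-(m.action n x h / N))) ∂m.histRate n x := by
  rw [(m.scale N).lintegral_histLaw n x hF h0]
  simp only [m.action_scale]
  refine m.lintegral_histRate_scale hN n x (hF.mul (ENNReal.measurable_ofReal.comp
    (Real.measurable_exp.comp (Measurable.neg ?_))))
  exact (m.measurable_action_right n x).div_const _

/-- Letting `N → ∞`, the rescaled laws increase to the product of rates and Lebesgue measure. -/
theorem Model.monotone_lintegral_histLaw_scale (n : ℕ)
    (x : Fin (n + 1) → Particle S) {F : Hist S n → ℝ≥0∞}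
    (hF : Measurable F) (h0 : ∀ h, h.total n = ∞ → F h = 0) :
    Monotone (fun N : ℕ => ((N + 1 : ℕ) : ℝ≥0∞) ^ n *
      ∫⁻ h, F h ∂(m.scale (N + 1)).histLaw n x) ∧
    Tendsto (fun N : ℕ => ((N + 1 : ℕ) : ℝ≥0∞) ^ n *
      ∫⁻ h, F h ∂(m.scale (N + 1)).histLaw n x) atTop (𝓝 (∫⁻ h, F h ∂m.histRate n x)) := by
  simp only [fun N : ℕ => m.lintegral_histLaw_scale N.succ_ne_zero n x hF h0]
  have hmono : ∀ h, Monotone fun N : ℕ =>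
      F h * ENNReal.ofReal (Real.exp (-(m.action n x h / (N + 1 : ℕ)))) := by
    intro h M N hMN
    -- The action is nonnegative, so dividing it by a larger number increases the exponential.
    have := m.action_nonneg n x h
    dsimp only
    gcongr
  refine ⟨fun M N hMN => lintegral_mono fun h => hmono h hMN,
    lintegral_tendsto_of_tendsto_of_monotone (fun N => ?_) (.of_forall hmono)
      (.of_forall fun h => ?_)⟩
  · exact (hF.mul (ENNReal.measurable_ofReal.comp (Real.measurable_exp.comp
      ((m.measurable_action_right n x).div_const _).neg))).aemeasurable
  · have h1 : Tendsto (fun N : ℕ => Real.exp (-(m.action n x h / (N + 1 : ℕ)))) atTop (𝓝 1) := by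
      rw [← Real.exp_zero, ← neg_zero]
      refine (Real.continuous_exp.tendsto _).comp (Tendsto.neg ?_)
      exact (tendsto_const_div_atTop_nhds_zero_nat _).comp (tendsto_add_atTop_nat 1)
    have h2 := (ENNReal.continuous_ofReal.tendsto _).comp h1
    rw [ENNReal.ofReal_one] at h2
    have h3 := ENNReal.Tendsto.const_mul (a := F h) h2 (Or.inl one_ne_zero)
    rwa [mul_one] at h3

end Integrals

end Coag

namespace Coag

/-! ### Invariance under permutations of the particle labels. -/

section Relabelling

/-- The unordered pair of the new labels of a pair. -/
def Pair.relabel {n : ℕ} (σ : Equiv.Perm (Fin n)) (p : Pair n) : Pair n :=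
  if h : σ p.1.1 < σ p.1.2 then ⟨(σ p.1.1, σ p.1.2), h⟩
  else ⟨(σ p.1.2, σ p.1.1), lt_of_le_of_ne (not_lt.1 h) fun e => p.2.ne' (σ.injective e)⟩

theorem Pair.relabel_injective {n : ℕ} (σ : Equiv.Perm (Fin n)) :
    Function.Injective (Pair.relabel σ) := by
  rintro ⟨⟨i, j⟩, hij⟩ ⟨⟨i', j'⟩, hij'⟩ h
  have h' := congrArg Subtype.val h
  simp only [Pair.relabel] at h'
  simp only at hij hij'
  -- If `σ` keeps the order of one pair and reverses that of the other, equal images would force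
  -- `(i', j') = (j, i)`, against `i < j` and `i' < j'`.
  split_ifs at h' <;> simp only [Prod.mk.injEq, EmbeddingLike.apply_eq_iff_eq] at h' <;>
    obtain ⟨rfl, rfl⟩ := h' <;> first | rfl | exact absurd hij hij'.asymm

theorem Pair.relabel_bijective {n : ℕ} (σ : Equiv.Perm (Fin n)) :
    Function.Bijective (Pair.relabel σ) :=
  Finite.injective_iff_bijective.1 (Pair.relabel_injective σ)

/-- A permutation that agrees with `σ` off the pair `p` and maps `p` to its relabelling, preserving
the order. -/
def Pair.align {n : ℕ} (σ : Equiv.Perm (Fin n)) (p : Pair n) : Equiv.Perm (Fin n) :=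
  if σ p.1.1 < σ p.1.2 then σ else σ.trans (Equiv.swap (σ p.1.1) (σ p.1.2))

theorem Pair.align_fst {n : ℕ} (σ : Equiv.Perm (Fin n)) (p : Pair n) :
    p.align σ p.1.1 = (p.relabel σ).1.1 := by
  unfold Pair.align Pair.relabel; split_ifs <;> simp

theorem Pair.align_snd {n : ℕ} (σ : Equiv.Perm (Fin n)) (p : Pair n) :
    p.align σ p.1.2 = (p.relabel σ).1.2 := by
  unfold Pair.align Pair.relabel; split_ifs <;> simp

theorem Pair.align_of_ne {n : ℕ} (σ : Equiv.Perm (Fin n)) (p : Pair n) {l : Fin n}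
    (h1 : l ≠ p.1.1) (h2 : l ≠ p.1.2) : p.align σ l = σ l := by
  unfold Pair.align
  split_ifs
  · rfl
  · exact Equiv.swap_apply_of_ne_of_ne (σ.injective.ne h1) (σ.injective.ne h2)

/-- The permutation of the labels of the merged system that `σ` induces. -/
def Pair.mergePerm {n : ℕ} (σ : Equiv.Perm (Fin (n + 2))) (p : Pair (n + 2)) :
    Equiv.Perm (Fin (n + 1)) :=
  (finSuccAboveEquiv p.1.2).trans
    (((p.align σ).subtypeEquiv fun l => by
        rw [← p.align_snd, (p.align σ).injective.ne_iff]).trans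
      (finSuccAboveEquiv (p.relabel σ).1.2).symm)

/-- `mergePerm` is `p.align σ` read through the numberings of the surviving labels. The aligned
permutation is used because the new particle takes the smaller label: when `σ` reverses the pair,
`σ` itself would send the removed label to the label that survives. -/
theorem Pair.succAbove_mergePerm {n : ℕ} (σ : Equiv.Perm (Fin (n + 2))) (p : Pair (n + 2))
    (l : Fin (n + 1)) :
    (p.relabel σ).1.2.succAbove (p.mergePerm σ l) = p.align σ (p.1.2.succAbove l) := by
  have h := congrArg Subtype.val ((finSuccAboveEquiv (p.relabel σ).1.2).apply_symm_apply
    ((p.align σ).subtypeEquiv (fun l => by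
      rw [← p.align_snd, (p.align σ).injective.ne_iff]) (finSuccAboveEquiv p.1.2 l)))
  exact h

variable {S : Type*}

theorem add_snd_relabel {n : ℕ} (x : Fin n → Particle S) (σ : Equiv.Perm (Fin n)) (p : Pair n) :
    (x (p.relabel σ).1.1).2 + (x (p.relabel σ).1.2).2 = (x (σ p.1.1)).2 + (x (σ p.1.2)).2 := by
  unfold Pair.relabel
  split_ifs
  · rfl
  · exact add_comm _ _

/-- Coagulation commutes with relabelling. This drives every induction below: after one step the
relabelled system is again a relabelling of the merged one, by a permutation that depends on the
pair. -/
theorem merge_comp_mergePerm {n : ℕ} (x : Fin (n + 2) → Particle S)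
    (σ : Equiv.Perm (Fin (n + 2))) (p : Pair (n + 2)) (z : S) :
    merge x (p.relabel σ) z ∘ p.mergePerm σ = merge (x ∘ σ) p z := by
  funext l
  simp only [merge, Function.comp_apply, p.succAbove_mergePerm, add_snd_relabel]
  by_cases hl : p.1.2.succAbove l = p.1.1
  · rw [hl, p.align_fst, Function.update_self, Function.update_self]
  · rw [Function.update_of_ne hl, Function.update_of_ne, p.align_of_ne σ hl (Fin.succAbove_ne _ _)]
    · rfl
    · rw [← p.align_fst]
      exact (p.align σ).injective.ne hl

/-- The history of the relabelled system. -/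
def Hist.relabel : (n : ℕ) → Equiv.Perm (Fin (n + 1)) → Hist S n → Hist S n
  | 0, _, h => h
  | n + 1, σ, (((p, z), s), h) => (((p.relabel σ, z), s), Hist.relabel n (p.mergePerm σ) h)

theorem conf_comp_perm {n : ℕ} (x : Fin n → Particle S) (σ : Equiv.Perm (Fin n)) :
    conf (x ∘ σ) = conf x := by
  simp only [conf]
  rw [← Multiset.map_map, Multiset.map_univ_val_equiv]

/-- A configuration is a multiset and does not see the labels, while pairs, sites and waiting times
correspond step by step. -/
theorem Hist.path_relabel (n : ℕ) (x : Fin (n + 1) → Particle S) (σ : Equiv.Perm (Fin (n + 1)))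
    (h : Hist S n) (t : ℝ) :
    (Hist.relabel n σ h).path n x t = h.path n (x ∘ σ) t := by
  induction n generalizing t with
  | zero => exact (conf_comp_perm x σ).symm
  | succ n ih =>
    obtain ⟨⟨⟨p, z⟩, s⟩, h⟩ := h
    simp only [Hist.relabel, Hist.path, ih, merge_comp_mergePerm, conf_comp_perm]

theorem Hist.restrict_relabel (T : ℝ≥0) {n : ℕ} (x : Fin (n + 1) → Particle S)
    (σ : Equiv.Perm (Fin (n + 1))) (h : Hist S n) :
    (Hist.relabel n σ h).restrict T x = h.restrict T (x ∘ σ) :=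
  funext fun t => Hist.path_relabel n x σ h t

variable [MeasurableSpace S] (m : Model S)

theorem Hist.measurable_relabel (n : ℕ) (σ : Equiv.Perm (Fin (n + 1))) :
    Measurable (Hist.relabel (S := S) n σ) := by
  induction n with
  | zero => exact measurable_id
  | succ n ih =>
    have h : Measurable fun b : Pair (n + 2) × ((S × ℝ≥0∞) × Hist S n) =>
        (((b.1.relabel σ, b.2.1.1), b.2.1.2), Hist.relabel n (b.1.mergePerm σ) b.2.2) := by
      -- The permutation passed on depends on the pair, but there are finitely many pairs, so
      -- measurability is checked for each fixed one.
      refine measurable_from_prod_countable_right fun p => ?_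
      exact (((measurable_const (a := p.relabel σ)).prodMk measurable_fst.fst).prodMk
        measurable_fst.snd).prodMk ((ih (p.mergePerm σ)).comp measurable_snd)
    have h' : Measurable fun a : ((Pair (n + 2) × S) × ℝ≥0∞) × Hist S n =>
        (a.1.1.1, ((a.1.1.2, a.1.2), a.2)) :=
      measurable_fst.fst.fst.prodMk
        ((measurable_fst.fst.snd.prodMk measurable_fst.snd).prodMk measurable_snd)
    exact h.comp h'

theorem Model.pairRate_relabel {n : ℕ} (x : Fin n → Particle S) (σ : Equiv.Perm (Fin n))
    (p : Pair n) : m.pairRate x (p.relabel σ) = m.pairRate (x ∘ σ) p := by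
  unfold Pair.relabel
  split_ifs
  · rfl
  · exact m.symm_K _ _

theorem Model.placement_relabel {n : ℕ} (x : Fin n → Particle S) (σ : Equiv.Perm (Fin n))
    (p : Pair n) : m.Υ (x (p.relabel σ).1.1, x (p.relabel σ).1.2) =
      m.Υ ((x ∘ σ) p.1.1, (x ∘ σ) p.1.2) := by
  unfold Pair.relabel
  split_ifs
  · rfl
  · exact m.symm_Υ _ _

theorem Model.totalRate_comp_perm {n : ℕ} (x : Fin n → Particle S) (σ : Equiv.Perm (Fin n)) :
    m.totalRate (x ∘ σ) = m.totalRate x :=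
  Fintype.sum_bijective _ (Pair.relabel_bijective σ) _ _ fun p => (m.pairRate_relabel x σ p).symm

theorem Model.action_relabel (n : ℕ) (x : Fin (n + 1) → Particle S)
    (σ : Equiv.Perm (Fin (n + 1))) (h : Hist S n) :
    m.action n x (Hist.relabel n σ h) = m.action n (x ∘ σ) h := by
  induction n with
  | zero => rfl
  | succ n ih =>
    obtain ⟨⟨⟨p, z⟩, s⟩, h⟩ := h
    simp only [Hist.relabel, Model.action, ih, merge_comp_mergePerm, m.totalRate_comp_perm]

theorem Model.lintegral_rate_relabel {n : ℕ} (x : Fin n → Particle S) (σ : Equiv.Perm (Fin n))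
    {f : Pair n × S → ℝ≥0∞} (hf : Measurable f) :
    ∫⁻ b, f (b.1.relabel σ, b.2) ∂m.rate n (x ∘ σ) = ∫⁻ b, f b ∂m.rate n x := by
  have hr : Measurable fun b : Pair n × S => (b.1.relabel σ, b.2) :=
    ((Measurable.of_discrete (f := Pair.relabel σ)).comp measurable_fst).prodMk measurable_snd
  have hfr : Measurable fun b : Pair n × S => f (b.1.relabel σ, b.2) := hf.comp hr
  rw [m.lintegral_rate n x hf, m.lintegral_rate n _ hfr]
  refine Fintype.sum_bijective _ (Pair.relabel_bijective σ) _ _ fun p => ?_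
  rw [m.pairRate_relabel, m.placement_relabel]

/-- The product of rates and Lebesgue measure does not depend on the labelling of the particles. -/
theorem Model.lintegral_histRate_relabel (n : ℕ) (x : Fin (n + 1) → Particle S)
    (σ : Equiv.Perm (Fin (n + 1))) {F : Hist S n → ℝ≥0∞} (hF : Measurable F) :
    ∫⁻ h, F (Hist.relabel n σ h) ∂m.histRate n (x ∘ σ) = ∫⁻ h, F h ∂m.histRate n x := by
  induction n with
  | zero => rw [m.lintegral_histRate_zero, m.lintegral_histRate_zero]; rfl
  | succ n ih =>
    have hG := m.measurable_lintegral_histRate_merge n x hF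
    have hr : Measurable fun a : (Pair (n + 2) × S) × ℝ≥0∞ =>
        ((a.1.1.relabel σ, a.1.2), a.2) :=
      (((Measurable.of_discrete (f := Pair.relabel σ)).comp measurable_fst.fst).prodMk
        measurable_fst.snd).prodMk measurable_snd
    have hFr : Measurable fun h : Hist S (n + 1) => F (Hist.relabel (n + 1) σ h) :=
      hF.comp (Hist.measurable_relabel _ σ)
    rw [m.lintegral_histRate_succ n x hF, m.lintegral_histRate_succ n _ hFr]
    have h1 : ∀ a : (Pair (n + 2) × S) × ℝ≥0∞,
        ∫⁻ h, F (Hist.relabel (n + 1) σ (a, h)) ∂m.histRate n (merge (x ∘ σ) a.1.1 a.1.2) =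
          ∫⁻ h, F (((a.1.1.relabel σ, a.1.2), a.2), h)
            ∂m.histRate n (merge x (a.1.1.relabel σ) a.1.2) := by
      rintro ⟨⟨p, z⟩, s⟩
      -- The tail is relabelled by the induced permutation of the merged system.
      have := ih (merge x (p.relabel σ) z) (p.mergePerm σ)
        (F := fun h => F (((p.relabel σ, z), s), h)) (hF.comp measurable_prodMk_left)
      rw [merge_comp_mergePerm] at this
      exact this
    have hGr := hG.comp hr
    simp only [Function.comp_def] at hGr
    rw [lintegral_congr h1, m.lintegral_stepRate n _ hGr, m.lintegral_stepRate n x hG]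
    exact m.lintegral_rate_relabel x σ (Measurable.lintegral_prod_right' hG)

/-- Equal multiplicities mean that the fibres of `x` and `y` over each value have the same size;
bijections between the fibres glue to a permutation. -/
theorem exists_perm_of_map_eq {α : Type*} {n : ℕ} {x y : Fin n → α}
    (h : Finset.univ.val.map x = Finset.univ.val.map y) : ∃ σ : Equiv.Perm (Fin n), y = x ∘ σ := by
  classical
  have hc : ∀ c, Nonempty ({i // y i = c} ≃ {i // x i = c}) := by
    intro c
    rw [← Fintype.card_eq]
    have := congrArg (Multiset.count c) h
    rw [Multiset.count_map, Multiset.count_map] at this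
    simp only [eq_comm (a := c)] at this
    rw [Fintype.card_subtype, Fintype.card_subtype]
    exact this.symm
  refine ⟨Equiv.ofFiberEquiv fun c => (hc c).some, funext fun i => ?_⟩
  exact (Equiv.ofFiberEquiv_map (fun c => (hc c).some) i).symm

end Relabelling

end Coag

namespace Coag

/-! ### Bounds on the rates from `H`, and finiteness of the product of rates and Lebesgue measure.
-/

section Finiteness

variable {S : Type*} [MeasurableSpace S] (m : Model S)

/-- The measures `m⁻¹ δ_y` and `m'⁻¹ δ_{y'}` have norm one, so they are admissible in the supremum
`H`, where they give `K(y, y') / (m m')`. -/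
theorem Model.K_le (y y' : Particle S) :
    (m.K y y' : ℝ≥0∞) ≤ m.H * ((y.2 : ℕ) * (y'.2 : ℕ)) := by
  have hne : ∀ k : ℕ+, ((k : ℕ) : ℝ≥0∞) ≠ 0 := fun k => by exact_mod_cast k.ne_zero
  have hnorm : ∀ y : Particle S,
      ∫⁻ a, (((a.2 : ℕ) : ℝ≥0∞)) ∂((y.2 : ℕ) : ℝ≥0∞)⁻¹ • Measure.dirac y ≤ 1 := by
    intro y
    have hm : Measurable fun a : Particle S => (((a.2 : ℕ) : ℝ≥0∞)) :=
      (Measurable.of_discrete (f := fun k : ℕ+ => ((k : ℕ) : ℝ≥0∞))).comp measurable_snd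
    rw [lintegral_smul_measure, lintegral_dirac' _ hm, smul_eq_mul,
      ENNReal.inv_mul_cancel (hne _) (ENNReal.natCast_ne_top _)]
  have hH : ∫⁻ a, ∫⁻ a', m.K a a' ∂(((y'.2 : ℕ) : ℝ≥0∞)⁻¹ • Measure.dirac y')
      ∂(((y.2 : ℕ) : ℝ≥0∞)⁻¹ • Measure.dirac y) ≤ m.H :=
    le_iSup_of_le _ (le_iSup_of_le _ (le_iSup_of_le (hnorm y)
      (le_iSup_of_le (hnorm y') le_rfl)))
  have hK : Measurable fun a : Particle S × Particle S => (m.K a.1 a.2 : ℝ≥0∞) :=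
    measurable_coe_nnreal_ennreal.comp m.measurable_K
  have hi : ∀ a, ∫⁻ a', m.K a a' ∂(((y'.2 : ℕ) : ℝ≥0∞)⁻¹ • Measure.dirac y') =
      ((y'.2 : ℕ) : ℝ≥0∞)⁻¹ * m.K a y' := fun a => by
    have h : Measurable fun a' => (m.K a a' : ℝ≥0∞) := hK.comp measurable_prodMk_left
    rw [lintegral_smul_measure, lintegral_dirac' _ h, smul_eq_mul]
  have hm : Measurable fun a : Particle S => ((y'.2 : ℕ) : ℝ≥0∞)⁻¹ * m.K a y' :=
    (hK.comp measurable_prodMk_right).const_mul _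
  simp only [hi] at hH
  rw [lintegral_smul_measure, lintegral_dirac' _ hm, smul_eq_mul] at hH
  calc (m.K y y' : ℝ≥0∞)
      = ((y.2 : ℕ) * ((y.2 : ℕ) : ℝ≥0∞)⁻¹) * ((y'.2 : ℕ) * ((y'.2 : ℕ) : ℝ≥0∞)⁻¹) * m.K y y' := by
        rw [ENNReal.mul_inv_cancel (hne _) (ENNReal.natCast_ne_top _),
          ENNReal.mul_inv_cancel (hne _) (ENNReal.natCast_ne_top _), one_mul, one_mul]
    _ = ((y.2 : ℕ) : ℝ≥0∞)⁻¹ * (((y'.2 : ℕ) : ℝ≥0∞)⁻¹ * m.K y y') *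
          ((y.2 : ℕ) * (y'.2 : ℕ)) := by ring
    _ ≤ m.H * ((y.2 : ℕ) * (y'.2 : ℕ)) := by gcongr

/-- After bounding each `K`, the sum over pairs `i < j` is enlarged to all ordered pairs, where it
factors as the square of the total mass. -/
theorem Model.totalRate_le {n : ℕ} (x : Fin n → Particle S) :
    (m.totalRate x : ℝ≥0∞) ≤ m.H * (massOf (conf x) : ℝ≥0∞) ^ 2 := by
  rw [Model.totalRate, ENNReal.ofNNReal_finsetSum, massOf_conf]
  calc ∑ p : Pair n, (m.pairRate x p : ℝ≥0∞)
      ≤ ∑ p : Pair n, m.H * (((x p.1.1).2 : ℕ) * ((x p.1.2).2 : ℕ)) :=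
        Finset.sum_le_sum fun p _ => m.K_le _ _
    _ = m.H * ∑ p : Pair n, ((((x p.1.1).2 : ℕ) : ℝ≥0∞) * ((x p.1.2).2 : ℕ)) := by
        rw [Finset.mul_sum]
    _ ≤ m.H * ∑ p : Fin n × Fin n, ((((x p.1).2 : ℕ) : ℝ≥0∞) * ((x p.2).2 : ℕ)) := by
        gcongr
        exact (Finset.sum_map Finset.univ (Function.Embedding.subtype _)
          (fun p : Fin n × Fin n => (((x p.1).2 : ℕ) : ℝ≥0∞) * ((x p.2).2 : ℕ))).symm.trans_le
          (Finset.sum_le_sum_of_subset (Finset.subset_univ _))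
    _ = m.H * ((∑ i, ((x i).2 : ℕ) : ℕ) : ℝ≥0∞) ^ 2 := by
        rw [Fintype.sum_prod_type, pow_two, Nat.cast_sum, Finset.sum_mul_sum]

/-- Each coagulation contributes at most its total rate times the length `T` of the time window. The
simplex of waiting times is replaced by the cube `[0, T]^n`, which loses a factor `n!` but makes the
bound a plain power. -/
theorem Model.histRate_total_le (n : ℕ) (x : Fin (n + 1) → Particle S) (T : ℝ≥0) :
    m.histRate n x {h | h.total n ≤ T} ≤ (m.H * (massOf (conf x) : ℝ≥0∞) ^ 2 * T) ^ n := by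
  induction n with
  | zero =>
    have hs : MeasurableSet {h : Hist S 0 | h.total 0 ≤ T} :=
      measurableSet_le (Hist.measurable_total 0) measurable_const
    rw [← lintegral_indicator_one hs, m.lintegral_histRate_zero, pow_zero]
    exact Set.indicator_le_self' (fun _ _ => zero_le) _
  | succ n ih =>
    have hs : MeasurableSet {h : Hist S (n + 1) | h.total (n + 1) ≤ T} :=
      measurableSet_le (Hist.measurable_total _) measurable_const
    set C := m.H * (massOf (conf x) : ℝ≥0∞) ^ 2 * T
    rw [← lintegral_indicator_one hs,
      m.lintegral_histRate_succ n x (measurable_one.indicator hs)]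
    have hle : ∀ a : (Pair (n + 2) × S) × ℝ≥0∞,
        ∫⁻ h, Set.indicator {h : Hist S (n + 1) | h.total (n + 1) ≤ T} 1 (a, h)
            ∂m.histRate n (merge x a.1.1 a.1.2) ≤
          (Set.Iic (T : ℝ≥0∞)).indicator 1 a.2 * C ^ n := by
      rintro ⟨⟨p, z⟩, s⟩
      have hn : MeasurableSet {h : Hist S n | h.total n ≤ T} :=
        measurableSet_le (Hist.measurable_total _) measurable_const
      have hb : ∀ h : Hist S n,
          Set.indicator {h : Hist S (n + 1) | h.total (n + 1) ≤ T} (fun _ => (1 : ℝ≥0∞))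
            (((p, z), s), h) ≤ (Set.Iic (T : ℝ≥0∞)).indicator 1 s *
              Set.indicator {h : Hist S n | h.total n ≤ T} 1 h := by
        intro h
        by_cases hh : ((((p, z), s), h) : Hist S (n + 1)) ∈ {h : Hist S (n + 1) | h.total _ ≤ T}
        swap
        · exact (Set.indicator_of_notMem hh _).trans_le zero_le
        have hh' : s + h.total n ≤ T := hh
        refine (Set.indicator_of_mem hh _).trans_le ?_
        rw [Set.indicator_of_mem (Set.mem_Iic.2 (le_self_add.trans hh')),
          Set.indicator_of_mem (show h ∈ {h : Hist S n | h.total n ≤ T} from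
            le_add_self.trans hh')]
        simp
      refine (lintegral_mono hb).trans ?_
      rw [lintegral_const_mul _ (measurable_one.indicator hn), lintegral_indicator_one hn]
      gcongr
      -- Coagulation conserves mass, so the constant `C` is the same for the merged system.
      exact (ih (merge x p z)).trans_eq (by rw [massOf_merge])
    have hg : Measurable fun a : (Pair (n + 2) × S) × ℝ≥0∞ =>
        (Set.Iic (T : ℝ≥0∞)).indicator (1 : ℝ≥0∞ → ℝ≥0∞) a.2 * C ^ n :=
      ((measurable_one.indicator measurableSet_Iic).comp measurable_snd).mul_const _
    refine (lintegral_mono hle).trans ?_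
    rw [m.lintegral_stepRate n x hg]
    simp only
    rw [lintegral_mul_const _ (measurable_one.indicator measurableSet_Iic),
      lintegral_indicator_one measurableSet_Iic, lebesgue_Iic, lintegral_const, m.rate_univ]
    calc (T : ℝ≥0∞) * C ^ n * m.totalRate x = C ^ n * (m.totalRate x * T) := by ring
      _ ≤ C ^ n * C := by gcongr; exact mul_le_mul_left (m.totalRate_le x) _
      _ = C ^ (n + 1) := (pow_succ _ _).symm

end Finiteness

end Coag

namespace Coag

/-! ### From integrals over `Γ_T^(1)` to integrals over histories; the number of initial atoms. -/

section Trajectories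

theorem Hist.path_zero {S : Type*} (n : ℕ) (x : Fin (n + 1) → Particle S) (h : Hist S n)
    (hp : h.Pos n) : h.path n x 0 = conf x := by
  cases n with
  | zero => rfl
  | succ n =>
    obtain ⟨⟨⟨p, z⟩, s⟩, h⟩ := h
    simp only [Hist.path, ENNReal.ofReal_zero]
    exact if_pos hp.1

theorem atoms_pathMap {S : Type*} {T : ℝ≥0} (n : ℕ) (ω : oneSet S T n) : (pathMap S T n ω).atoms = n + 1 := by
  have hp := ((isOneTraj_iff ω.1.1 ω.1.2).1 ω.2).2.1
  have : (pathMap S T n ω).1 ⟨0, le_rfl, T.2⟩ = conf ω.1.1 := Hist.path_zero n _ _ hp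
  rw [OneTraj.atoms, this, card_conf]

theorem Config.toMeasure_univ {S : Type*} [MeasurableSpace S] (φ : Config S) :
    φ.toMeasure Set.univ = (Multiset.card φ : ℝ≥0∞) := by
  induction φ using Multiset.induction_on with
  | empty => simp [Config.toMeasure]
  | cons y φ ih =>
    have : Config.toMeasure (y ::ₘ φ) = Measure.dirac y + Config.toMeasure φ := by
      simp [Config.toMeasure]
    rw [this, Measure.add_apply, ih]
    simp [add_comm]

/-- The function `f` of the path as a function of the initial particles and the history, equal to
zero off the event that the path lies in `Γ_T^(1)`. -/
noncomputable def pathExtend {S : Type*} (T : ℝ≥0) (n : ℕ) (f : OneTraj S T → ℝ≥0∞) :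
    (Fin (n + 1) → Particle S) × Hist S n → ℝ≥0∞ :=
  Function.extend Subtype.val (f ∘ pathMap S T n) 0

theorem pathExtend_of_mem {S : Type*} {T : ℝ≥0} {n : ℕ} (f : OneTraj S T → ℝ≥0∞)
    {ω : (Fin (n + 1) → Particle S) × Hist S n} (hω : ω ∈ oneSet S T n) :
    pathExtend T n f ω = f (pathMap S T n ⟨ω, hω⟩) :=
  Subtype.val_injective.extend_apply (f ∘ pathMap S T n) 0 ⟨ω, hω⟩

theorem pathExtend_of_notMem {S : Type*} {T : ℝ≥0} {n : ℕ} (f : OneTraj S T → ℝ≥0∞)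
    {ω : (Fin (n + 1) → Particle S) × Hist S n} (hω : ω ∉ oneSet S T n) :
    pathExtend T n f ω = 0 :=
  Function.extend_apply' _ _ _ fun ⟨a, ha⟩ => hω (ha ▸ a.2)

/-- Testing the Lévy–Prokhorov inequality on the whole space shows that the mass of `φ` exceeds that
of `ψ` by less than one, and both are integers. -/
theorem card_le_of_levyProkhorovEDist_lt_one {S : Type*} [MetricSpace S] [MeasurableSpace S]
    {φ ψ : Config S} (h : levyProkhorovEDist φ.toMeasure ψ.toMeasure < 1) :
    Multiset.card φ ≤ Multiset.card ψ := by
  obtain ⟨c, hc, hc1⟩ := exists_between h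
  have h1 := (left_measure_le_of_levyProkhorovEDist_lt hc MeasurableSet.univ).trans
    (add_le_add_left (measure_mono (Set.subset_univ _)) _)
  rw [Config.toMeasure_univ, Config.toMeasure_univ] at h1
  have h2 : (Multiset.card φ : ℝ≥0∞) < Multiset.card ψ + 1 :=
    h1.trans_lt (ENNReal.add_lt_add_left (ENNReal.natCast_ne_top _) hc1)
  exact Nat.lt_succ_iff.1 (by exact_mod_cast h2)

theorem pathExtend_eq_zero_of_total {S : Type*} {T : ℝ≥0} {n : ℕ} (f : OneTraj S T → ℝ≥0∞)
    (x : Fin (n + 1) → Particle S) {h : Hist S n} (hh : h.total n = ∞) :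
    pathExtend T n f (x, h) = 0 := by
  refine pathExtend_of_notMem f fun hω => ?_
  have := ((isOneTraj_iff x h).1 hω).2.2
  rw [hh] at this
  exact ENNReal.coe_ne_top (top_le_iff.1 this)

theorem pathExtend_relabel {S : Type*} {T : ℝ≥0} {n : ℕ} (f : OneTraj S T → ℝ≥0∞)
    (x : Fin (n + 1) → Particle S) (σ : Equiv.Perm (Fin (n + 1))) (h : Hist S n) :
    pathExtend T n f (x, Hist.relabel n σ h) = pathExtend T n f (x ∘ σ, h) := by
  have hr := Hist.restrict_relabel T x σ h
  have hiff : (x, Hist.relabel n σ h) ∈ oneSet S T n ↔ (x ∘ σ, h) ∈ oneSet S T n := by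
    simp only [oneSet, Set.mem_ofPred_eq, hr]
  by_cases hω : (x ∘ σ, h) ∈ oneSet S T n
  · rw [pathExtend_of_mem f hω, pathExtend_of_mem f (hiff.2 hω)]
    exact congrArg f (Subtype.ext hr)
  · rw [pathExtend_of_notMem f hω, pathExtend_of_notMem f (hiff.not.2 hω)]

variable {S : Type*} [MetricSpace S] [SecondCountableTopology S] [MeasurableSpace S]
  [BorelSpace S] {T : ℝ≥0}

/-- Time changes fix `0`, so paths at distance less than one have initial configurations at
Lévy–Prokhorov distance less than one. Hence `atoms` is locally constant, which makes the weight `N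
^ (|ξ_0| - 1)` measurable. -/
theorem OneTraj.atoms_eq_of_edist_lt_one {ξ η : OneTraj S T} (h : edist ξ η < 1) :
    ξ.atoms = η.atoms := by
  have key : ∀ ξ η : OneTraj S T, edist ξ η < 1 → ξ.atoms ≤ η.atoms := by
    intro ξ η h
    obtain ⟨l, hl⟩ := iInf_lt_iff.1 (show skorokhodEDist ξ.1 η.1 < 1 from h)
    -- An order isomorphism fixes the least element.
    have h0 : l ⟨0, le_rfl, T.2⟩ = ⟨0, le_rfl, T.2⟩ := by
      refine le_antisymm ?_ (l ⟨0, le_rfl, T.2⟩).2.1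
      rw [← l.le_symm_apply]
      exact (l.symm ⟨0, le_rfl, T.2⟩).2.1
    have h1 := (le_iSup (fun t => levyProkhorovEDist (ξ.1 (l t)).toMeasure (η.1 t).toMeasure)
      ⟨0, le_rfl, T.2⟩).trans_lt ((le_max_right _ _).trans_lt hl)
    rw [h0] at h1
    exact card_le_of_levyProkhorovEDist_lt_one h1
  exact le_antisymm (key _ _ h) (key _ _ (by rwa [edist_comm]))

theorem OneTraj.measurable_atoms : Measurable (OneTraj.atoms : OneTraj S T → ℕ) := by
  refine Continuous.measurable (continuous_iff_continuousAt.2 fun ξ => ?_)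
  refine continuousAt_const.congr (f := fun _ => ξ.atoms) ?_
  filter_upwards [Metric.eball_mem_nhds ξ one_pos] with η hη
  exact (OneTraj.atoms_eq_of_edist_lt_one hη).symm

theorem measurable_pathExtend (n : ℕ) {f : OneTraj S T → ℝ≥0∞} (hf : Measurable f) :
    Measurable (pathExtend T n f) :=
  (MeasurableEmbedding.subtype_coe (measurableSet_oneSet T n)).measurable_extend
    (hf.comp (measurable_pathMap n)) measurable_const

/-- Extension by zero turns the restriction to the event into an ordinary integral over all
histories, to which the density formula applies. -/
theorem lintegral_onOneTraj {n : ℕ} (κ : Kernel (Fin (n + 1) → Particle S) (Hist S n))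
    [IsSFiniteKernel κ] (x : Fin (n + 1) → Particle S) {f : OneTraj S T → ℝ≥0∞}
    (hf : Measurable f) :
    ∫⁻ ξ, f ξ ∂onOneTraj T κ x = ∫⁻ h, pathExtend T n f (x, h) ∂κ x := by
  have hE := measurable_pathExtend n hf
  rw [onOneTraj, Kernel.map_apply _ (measurable_pathMap n),
    lintegral_map hf (measurable_pathMap n), Kernel.comapRight_apply,
    ← Kernel.lintegral_id_prod hE κ x,
    ← setLIntegral_eq_of_support_subset (s := oneSet S T n),
    ← lintegral_subtype_comap (measurableSet_oneSet T n)]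
  · exact lintegral_congr fun ω => (pathExtend_of_mem f ω.2).symm
  · intro ω hω
    by_contra h
    exact hω (pathExtend_of_notMem f h)

end Trajectories

/-! ### The measures `P`, `Q` and the Poisson mixtures: invariance, finiteness and monotone limits.
-/

section Convergence

theorem Atoms.measurable_fst {α : Type*} [MeasurableSpace α] :
    Measurable (Sigma.fst : Atoms α → ℕ) := by
  intro B _
  rw [MeasurableSpace.measurableSet_iInf]
  intro n
  exact (measurable_const (a := n) : Measurable fun _ : Fin n → α => n) (MeasurableSet.of_discrete)

theorem lintegral_fst_poi {S : Type*} [MeasurableSpace S] (μ : Measure S)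
    [IsProbabilityMeasure μ] (g : ℕ → ℝ≥0∞) :
    ∫⁻ k, g k.1 ∂poi μ =
      ∑' n : ℕ, ENNReal.ofReal (Real.exp (-1)) / (n.factorial : ℝ≥0∞) * g n := by
  rw [poi, lintegral_sum_measure]
  refine tsum_congr fun n => ?_
  have hs : Measurable (fun x => ⟨n, x⟩ : (Fin n → S) → Atoms S) := by
    intro B hB
    rw [MeasurableSpace.measurableSet_iInf] at hB
    exact hB n
  have hg : Measurable fun k : Atoms S => g k.1 :=
    (Measurable.of_discrete (f := g)).comp Atoms.measurable_fst
  have hmap : ∫⁻ k, g k.1 ∂(Measure.pi fun _ : Fin n => μ).map (Sigma.mk n) = g n :=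
    (lintegral_map hg hs).trans (by simp)
  rw [lintegral_smul_measure, hmap, smul_eq_mul, probReal_univ]

variable {S : Type*} [MetricSpace S] [SecondCountableTopology S] [MeasurableSpace S]
  [BorelSpace S] {T : ℝ≥0} (m : Model S)

theorem Model.P_zero (x : Fin 0 → S) : m.P T ⟨0, x⟩ = 0 := rfl

theorem Model.Q_zero (x : Fin 0 → S) : m.Q T ⟨0, x⟩ = 0 := rfl

theorem Model.lintegral_P_succ (n : ℕ) (x : Fin (n + 1) → S) {f : OneTraj S T → ℝ≥0∞}
    (hf : Measurable f) :
    ∫⁻ ξ, f ξ ∂m.P T ⟨n + 1, x⟩ =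
      ∫⁻ h, pathExtend T n f (fun i => (x i, 1), h) ∂m.histLaw n fun i => (x i, 1) :=
  lintegral_onOneTraj (m.histLaw n) _ hf

theorem Model.lintegral_Q_succ (n : ℕ) (x : Fin (n + 1) → S) {f : OneTraj S T → ℝ≥0∞}
    (hf : Measurable f) :
    ∫⁻ ξ, f ξ ∂m.Q T ⟨n + 1, x⟩ =
      ∫⁻ h, pathExtend T n f (fun i => (x i, 1), h) ∂m.histRate n fun i => (x i, 1) :=
  lintegral_onOneTraj (m.histRate n) _ hf

theorem measurable_pathExtend_right (n : ℕ) {f : OneTraj S T → ℝ≥0∞} (hf : Measurable f)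
    (x : Fin (n + 1) → Particle S) : Measurable fun h => pathExtend T n f (x, h) :=
  (measurable_pathExtend n hf).comp measurable_prodMk_left

/-- The full law of the history is not invariant under relabelling, because the dummy pair at zero
rate depends on the labels. On `Γ_T^(1)` this does not matter: there the law has a density relative
to `histRate`, and both the density and `histRate` are invariant. -/
theorem Model.P_comp_perm (n : ℕ) (x : Fin n → S) (σ : Equiv.Perm (Fin n)) :
    m.P T ⟨n, x ∘ σ⟩ = m.P T ⟨n, x⟩ := by
  cases n with
  | zero => rfl
  | succ n =>
    refine Measure.ext_of_lintegral _ fun f hf => ?_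
    have hE := measurable_pathExtend_right n hf
    have hF : Measurable fun h => pathExtend T n f (fun i => (x i, 1), h) *
        ENNReal.ofReal (Real.exp (-m.action n (fun i => (x i, 1)) h)) :=
      (hE _).mul (ENNReal.measurable_ofReal.comp (Real.measurable_exp.comp
        (m.measurable_action_right n _).neg))
    rw [m.lintegral_P_succ n _ hf, m.lintegral_P_succ n _ hf,
      m.lintegral_histLaw n _ (hE _) fun h hh => pathExtend_eq_zero_of_total f _ hh,
      m.lintegral_histLaw n _ (hE _) fun h hh => pathExtend_eq_zero_of_total f _ hh,
      ← m.lintegral_histRate_relabel n (fun i => (x i, 1)) σ hF]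
    refine lintegral_congr fun h => ?_
    rw [pathExtend_relabel, m.action_relabel]
    rfl

theorem Model.Q_comp_perm (n : ℕ) (x : Fin n → S) (σ : Equiv.Perm (Fin n)) :
    m.Q T ⟨n, x ∘ σ⟩ = m.Q T ⟨n, x⟩ := by
  cases n with
  | zero => rfl
  | succ n =>
    refine Measure.ext_of_lintegral _ fun f hf => ?_
    rw [m.lintegral_Q_succ n _ hf, m.lintegral_Q_succ n _ hf,
      ← m.lintegral_histRate_relabel n (fun i => (x i, 1)) σ (measurable_pathExtend_right n hf _)]
    refine lintegral_congr fun h => ?_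
    rw [pathExtend_relabel]
    rfl

theorem Atoms.exists_perm_of_config_eq {α : Type*} {k k' : Atoms α} (h : k.config = k'.config) :
    ∃ (n : ℕ) (x : Fin n → α) (σ : Equiv.Perm (Fin n)), k = ⟨n, x⟩ ∧ k' = ⟨n, x ∘ σ⟩ := by
  obtain ⟨n, x⟩ := k
  obtain ⟨n', y⟩ := k'
  obtain rfl : n = n' := by
    have := congrArg Multiset.card h
    simpa [Atoms.config] using this
  obtain ⟨σ, rfl⟩ := exists_perm_of_map_eq h
  exact ⟨n, x, σ, rfl, rfl⟩

theorem Model.P_univ_le (k : Atoms S) : m.P T k Set.univ ≤ 1 := by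
  obtain ⟨_ | n, x⟩ := k
  · rw [m.P_zero]; simp
  · rw [← lintegral_one, m.lintegral_P_succ n x measurable_const]
    calc _ ≤ ∫⁻ _, 1 ∂m.histLaw n fun i => (x i, 1) := lintegral_mono fun h => by
          by_cases hω : ((fun i => (x i, 1), h) : (Fin (n + 1) → Particle S) × Hist S n) ∈
              oneSet S T n
          · rw [pathExtend_of_mem _ hω]
          · rw [pathExtend_of_notMem _ hω]; exact zero_le
      _ = 1 := by simp

theorem Model.Q_univ_lt_top (hH : m.H < ∞) (k : Atoms S) : m.Q T k Set.univ < ∞ := by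
  obtain ⟨_ | n, x⟩ := k
  · rw [m.Q_zero]; simp
  · rw [← lintegral_one, m.lintegral_Q_succ n x measurable_const]
    have hs : MeasurableSet {h : Hist S n | h.total n ≤ T} :=
      measurableSet_le (Hist.measurable_total _) measurable_const
    calc _ ≤ ∫⁻ h, Set.indicator {h : Hist S n | h.total n ≤ T} 1 h
          ∂m.histRate n fun i => (x i, 1) := lintegral_mono fun h => by
            by_cases hω : ((fun i => (x i, 1), h) : (Fin (n + 1) → Particle S) × Hist S n) ∈
                oneSet S T n
            · have hT : h ∈ {h : Hist S n | h.total n ≤ T} := ((isOneTraj_iff _ _).1 hω).2.2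
              rw [pathExtend_of_mem _ hω, Set.indicator_of_mem hT, Pi.one_apply]
            · rw [pathExtend_of_notMem _ hω]; exact zero_le
      _ ≤ _ := (lintegral_indicator_one hs).trans_le (m.histRate_total_le n _ T)
      _ < ∞ := by finiteness

/-- The rescaled laws increase to `Q`. -/
theorem Model.monotone_lintegral_P_scale (k : Atoms S) {f : OneTraj S T → ℝ≥0∞}
    (hf : Measurable f) :
    Monotone (fun N : ℕ => ((N + 1 : ℕ) : ℝ≥0∞) ^ (k.1 - 1) *
      ∫⁻ ξ, f ξ ∂(m.scale (N + 1)).P T k) ∧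
    Tendsto (fun N : ℕ => ((N + 1 : ℕ) : ℝ≥0∞) ^ (k.1 - 1) *
      ∫⁻ ξ, f ξ ∂(m.scale (N + 1)).P T k) atTop (𝓝 (∫⁻ ξ, f ξ ∂m.Q T k)) := by
  obtain ⟨_ | n, x⟩ := k
  -- Without atoms the truncated exponent `0 - 1` is `0`, but both measures are zero.
  · simp only [Model.P_zero, Model.Q_zero, lintegral_zero_measure, mul_zero]
    exact ⟨monotone_const, tendsto_const_nhds⟩
  · simp only [Model.lintegral_P_succ _ n x hf, Model.lintegral_Q_succ _ n x hf,
      Nat.add_sub_cancel]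
    exact m.monotone_lintegral_histLaw_scale n _ (measurable_pathExtend_right n hf _)
      fun h hh => pathExtend_eq_zero_of_total f _ hh

/-- Paths under `P_k` start with exactly `|k|` atoms, so a weight depending on `|ξ_0|` is a
constant. -/
theorem Model.lintegral_atoms_mul_P (k : Atoms S) {g : ℕ → ℝ≥0∞} {f : OneTraj S T → ℝ≥0∞}
    (hf : Measurable f) :
    ∫⁻ ξ, g ξ.atoms * f ξ ∂m.P T k = g k.1 * ∫⁻ ξ, f ξ ∂m.P T k := by
  obtain ⟨_ | n, x⟩ := k
  · simp only [Model.P_zero, lintegral_zero_measure, mul_zero]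
  · have hg : Measurable fun ξ : OneTraj S T => g ξ.atoms :=
      (Measurable.of_discrete (f := g)).comp OneTraj.measurable_atoms
    have hgf : Measurable fun ξ : OneTraj S T => g ξ.atoms * f ξ := hg.mul hf
    rw [m.lintegral_P_succ n x hgf, m.lintegral_P_succ n x hf,
      ← lintegral_const_mul _ (measurable_pathExtend_right n hf _)]
    refine lintegral_congr fun h => ?_
    by_cases hω : ((fun i => (x i, 1), h) : (Fin (n + 1) → Particle S) × Hist S n) ∈ oneSet S T n
    · rw [pathExtend_of_mem _ hω, pathExtend_of_mem _ hω, atoms_pathMap]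
    · rw [pathExtend_of_notMem _ hω, pathExtend_of_notMem _ hω, mul_zero]

theorem Model.lintegral_refN (μ : Measure S) (N : ℕ) {f : OneTraj S T → ℝ≥0∞}
    (hf : Measurable f) :
    ∫⁻ ξ, f ξ ∂m.refN μ T N = ENNReal.ofReal (Real.exp 1) *
      ∫⁻ k, (N : ℝ≥0∞) ^ (k.1 - 1) * ∫⁻ ξ, f ξ ∂(m.scale N).P T k ∂poi μ := by
  have hd : Measurable fun ξ : OneTraj S T => (N : ℝ≥0∞) ^ (ξ.atoms - 1) :=
    (Measurable.of_discrete (f := fun n : ℕ => (N : ℝ≥0∞) ^ (n - 1))).comp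
      OneTraj.measurable_atoms
  rw [Model.refN, lintegral_withDensity_eq_lintegral_mul _ hd hf, lintegral_smul_measure,
    Measure.lintegral_bind (Kernel.aemeasurable _) (hd.mul hf).aemeasurable, smul_eq_mul]
  congr 1
  exact lintegral_congr fun k =>
    (m.scale N).lintegral_atoms_mul_P k (g := fun n : ℕ => (N : ℝ≥0∞) ^ (n - 1)) hf

theorem Model.lintegral_ref (μ : Measure S) {f : OneTraj S T → ℝ≥0∞} (hf : Measurable f) :
    ∫⁻ ξ, f ξ ∂m.ref μ T = ENNReal.ofReal (Real.exp 1) *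
      ∫⁻ k, ∫⁻ ξ, f ξ ∂m.Q T k ∂poi μ := by
  rw [Model.ref, lintegral_smul_measure,
    Measure.lintegral_bind (Kernel.aemeasurable _) hf.aemeasurable, smul_eq_mul]

/-- For each `k` the rescaled integrals increase to the integral against `Q_k`, so monotone
convergence applies to the Poisson integral as well. No bound on `M_μ` is required, and the limit
may be infinite. -/
theorem Model.tendsto_lintegral_refN (μ : Measure S) {f : OneTraj S T → ℝ≥0∞}
    (hf : Measurable f) :
    Tendsto (fun N : ℕ => ∫⁻ ξ, f ξ ∂m.refN μ T N) atTop (𝓝 (∫⁻ ξ, f ξ ∂m.ref μ T)) := by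
  -- The shift to `N + 1` avoids the degenerate kernel `K / 0 = 0`, for which monotonicity need not
  -- hold.
  rw [← tendsto_add_atTop_iff_nat 1]
  simp only [m.lintegral_refN μ _ hf, m.lintegral_ref μ hf]
  refine ENNReal.Tendsto.const_mul ?_ (Or.inr ENNReal.ofReal_ne_top)
  refine lintegral_tendsto_of_tendsto_of_monotone (fun N => ?_)
    (.of_forall fun k => (m.monotone_lintegral_P_scale k hf).1)
    (.of_forall fun k => (m.monotone_lintegral_P_scale k hf).2)
  exact (((Measurable.of_discrete (f := fun n : ℕ => ((N + 1 : ℕ) : ℝ≥0∞) ^ (n - 1))).comp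
    Atoms.measurable_fst).mul (hf.lintegral_kernel)).aemeasurable

theorem Model.refN_univ_lt_top (μ : Measure S) [IsProbabilityMeasure μ] (N : ℕ) :
    m.refN μ T N Set.univ < ∞ := by
  rw [← lintegral_one, m.lintegral_refN μ N measurable_const]
  refine ENNReal.mul_lt_top ENNReal.ofReal_lt_top ?_
  -- Passing to the base `N + 1 ≥ 1` absorbs the truncated exponent, also for `N = 0`, and leaves
  -- the exponential series of `N + 1`.
  have hle : ∀ n : ℕ, (N : ℝ≥0∞) ^ (n - 1) ≤ ((N + 1 : ℕ) : ℝ≥0∞) ^ n := fun n => by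
    exact_mod_cast (Nat.pow_le_pow_left N.le_succ _).trans
      (Nat.pow_le_pow_right N.succ_pos (Nat.sub_le n 1))
  calc ∫⁻ k, (N : ℝ≥0∞) ^ (k.1 - 1) * ∫⁻ _, 1 ∂(m.scale N).P T k ∂poi μ
      ≤ ∫⁻ k, ((N + 1 : ℕ) : ℝ≥0∞) ^ k.1 ∂poi μ := lintegral_mono fun k => by
        rw [lintegral_one]
        exact (mul_le_mul' (hle k.1) ((m.scale N).P_univ_le k)).trans_eq (mul_one _)
    _ = ∑' n : ℕ, ENNReal.ofReal (Real.exp (-1)) / (n.factorial : ℝ≥0∞) *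
          ((N + 1 : ℕ) : ℝ≥0∞) ^ n := lintegral_fst_poi μ fun n => ((N + 1 : ℕ) : ℝ≥0∞) ^ n
    _ = ∑' n : ℕ, ENNReal.ofReal (Real.exp (-1) * (((N + 1 : ℕ) : ℝ) ^ n / n.factorial)) := by
        refine tsum_congr fun n => ?_
        rw [ENNReal.ofReal_mul (Real.exp_nonneg _),
          ENNReal.ofReal_div_of_pos (by positivity), ENNReal.ofReal_pow (by positivity),
          ENNReal.ofReal_natCast, ENNReal.ofReal_natCast, div_eq_mul_inv, div_eq_mul_inv]
        ring
    _ < ∞ := ((Real.summable_pow_div_factorial _).mul_left _).tsum_ofReal_lt_top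

theorem Model.tendsto_lintegral_P_scale (k : Atoms S) {f : OneTraj S T → ℝ≥0∞}
    (hf : Measurable f) :
    Tendsto (fun N : ℕ => ∫⁻ ξ, f ξ ∂((N : ℝ≥0∞) ^ (k.1 - 1) • (m.scale N).P T k)) atTop
      (𝓝 (∫⁻ ξ, f ξ ∂m.Q T k)) := by
  rw [← tendsto_add_atTop_iff_nat 1]
  simp only [lintegral_smul_measure, smul_eq_mul]
  exact (m.monotone_lintegral_P_scale k hf).2

end Convergence

end Coag

/-! ### The theorem. -/

theorem lemma2p2 {S : Type*} [MetricSpace S] [CompleteSpace S] [SecondCountableTopology S]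
    [MeasurableSpace S] [BorelSpace S] (m : Coag.Model S) (hH : m.H < ∞)
    (μ : Measure S) [IsProbabilityMeasure μ] (T : ℝ≥0) (hT : 0 < T) :
    -- the laws depend on the vector of atoms only through its point measure
    (∀ k k' : Coag.Atoms S, k.config = k'.config →
      (∀ N : ℕ, (m.scale N).P T k = (m.scale N).P T k') ∧ m.Q T k = m.Q T k') ∧
    -- weak convergence, for every initial configuration
    (∀ k : Coag.Atoms S,
      ∃ (hN : ∀ N : ℕ, IsFiniteMeasure ((N : ℝ≥0∞) ^ (k.1 - 1) • (m.scale N).P T k))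
        (hQ : IsFiniteMeasure (m.Q T k)),
        Tendsto (β := FiniteMeasure (Coag.OneTraj S T))
          (fun N : ℕ => ⟨(N : ℝ≥0∞) ^ (k.1 - 1) • (m.scale N).P T k, hN N⟩)
          atTop (𝓝 ⟨m.Q T k, hQ⟩)) ∧
    -- convergence of the reference measures
    (∃ hN : ∀ N : ℕ, IsFiniteMeasure (m.refN μ T N),
      (∀ f : Coag.OneTraj S T →ᵇ ℝ≥0,
        Tendsto (fun N : ℕ => ∫⁻ ξ, f ξ ∂(m.refN μ T N)) atTop
          (𝓝 (∫⁻ ξ, f ξ ∂(m.ref μ T)))) ∧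
      (∀ hM : IsFiniteMeasure (m.ref μ T),
        Tendsto (β := FiniteMeasure (Coag.OneTraj S T)) (fun N : ℕ => ⟨m.refN μ T N, hN N⟩)
          atTop (𝓝 ⟨m.ref μ T, hM⟩))) := by
  have hf : ∀ f : Coag.OneTraj S T →ᵇ ℝ≥0, Measurable fun ξ => (f ξ : ℝ≥0∞) := fun f =>
    measurable_coe_nnreal_ennreal.comp f.continuous.measurable
  refine ⟨fun k k' h => ?_, fun k => ⟨fun N => ⟨?_⟩, ⟨m.Q_univ_lt_top hH k⟩, ?_⟩,
    fun N => ⟨m.refN_univ_lt_top μ N⟩, fun f => m.tendsto_lintegral_refN μ (hf f), fun _ => ?_⟩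
  · obtain ⟨n, x, σ, rfl, rfl⟩ := Coag.Atoms.exists_perm_of_config_eq h
    exact ⟨fun N => ((m.scale N).P_comp_perm n x σ).symm, (m.Q_comp_perm n x σ).symm⟩
  · rw [Measure.smul_apply, smul_eq_mul]
    exact ENNReal.mul_lt_top (ENNReal.pow_lt_top (ENNReal.natCast_lt_top N))
      (((m.scale N).P_univ_le k).trans_lt ENNReal.one_lt_top)
  -- Weak convergence tests bounded continuous functions only; the limit is already known for all
  -- measurable nonnegative ones.
  · exact FiniteMeasure.tendsto_iff_forall_lintegral_tendsto.2 fun f =>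
      m.tendsto_lintegral_P_scale k (hf f)
  · exact FiniteMeasure.tendsto_iff_forall_lintegral_tendsto.2 fun f =>
      m.tendsto_lintegral_refN μ (hf f)
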